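/- Let $M\ge 1$ be an integer, $N=M^3$, $\Omega>0$, and let $a^\dagger_{p,\sigma},a_{p,\sigma}$ be fermionic raising and lowering operators on the Fock space with $2N$ modes, with $p\in\{0,\dots,M-1\}^3$ and spin $\sigma\in\{\uparrow,\downarrow\}$; put $n_{p,\sigma}=a^\dagger_{p,\sigma}a_{p,\sigma}$ and $r_p=p\,(\Omega/N)^{1/3}$. Let $\nu$ range over the $N$ integer vectors with components in $\{-\lfloor M/2\rfloor,\dots,\lceil M/2\rceil-1\}$ (they label the same modes via $\nu_i=p_i-\lfloor M/2\rfloor$), and let $k_\nu=2\pi\nu/\Omega^{1/3}$, $k_\nu^2=k_\nu\cdot k_\nu$. For nuclei with charges $\zeta_1,\dots,\zeta_J\in\mathbb R$ at positions $R_1,\dots,R_J\in\mathbb R^3$, let $H=T+U+V$ with $$T=\frac1{2N}\sum_{\nu,p,q,\sigma}k_\nu^2\cos[k_\nu\cdot(r_q-r_p)]\,a^\dagger_{p,\sigma}a_{q,\sigma},\qquad U=-\frac{4\pi}{\Omega}\sum_{p,\sigma,j,\nu\ne0}\frac{\zeta_j\cos[k_\nu\cdot(R_j-r_p)]}{k_\nu^2}\,n_{p,\sigma},$$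 $$V=\frac{2\pi}{\Omega}\sum_{(p,\sigma)\ne(q,\sigma'),\ \nu\neq 0}\frac{\cos[k_\nu\cdot(r_p-r_q)]}{k_\nu^2}\,n_{p,\sigma}n_{q,\sigma'}.$$ Let $\mathrm{FFFT}$ be the unitary that fixes the vacuum and satisfies $\mathrm{FFFT}^\dagger a^\dagger_{\nu,\sigma}\,\mathrm{FFFT}=N^{-1/2}\sum_p e^{-ik_\nu\cdot r_p}a^\dagger_{p,\sigma}$ for all $\nu,\sigma$, and let $\tilde T=\frac12\sum_{\nu,\sigma}k_\nu^2\,a^\dagger_{\nu,\sigma}a_{\nu,\sigma}$. For an integer $\eta\ge0$ let $\mathcal K_\eta=\{\psi:\sum_{p,\sigma}n_{p,\sigma}\psi=\eta\psi\}$ be the $\eta$-electron manifold. For $t\ge0$ and $\epsilon>0$ put $$X=\frac{\eta^2N^{5/6}t^{3/2}}{\Omega^{5/6}\sqrt\epsilon}\sqrt{1+\frac{\eta\,\Omega^{1/3}}{N^{1/3}}}.$$ **Lemma.** For every constant $A$ there are constants $0<c_1\le c_2$, depending only on $A$, such that for all $M\ge1$, $\eta\ge0$, $\Omega>0$, $t\ge0$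 and $\epsilon>0$ there is an integer $r$ with $$c_1\max(1,X)\le r\le c_2\max(1,X)$$ (so $r=\Theta(X)$ whenever $X\ge1$) such that for all nuclei $(\zeta_j,R_j)_{j\le J}$ with $\sum_j\zeta_j=\eta$ and $\sum_j|\zeta_j|\le A\eta$, and for every unit vector $\psi\in\mathcal K_\eta$, $$\left|\langle\psi|\left(e^{-i(U+V)t/2r}\,\mathrm{FFFT}^\dagger\,e^{-i\tilde T t/r}\,\mathrm{FFFT}\,e^{-i(U+V)t/2r}\right)^r-e^{-iHt}|\psi\rangle\right|\le\epsilon .$$ -/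

import Mathlib

open scoped InnerProductSpace

noncomputable section

namespace PlaneWaveDual

section Fock

variable {ι : Type*} [LinearOrder ι] [Fintype ι]

/-- Fermionic Fock space over the finite, ordered set `ι` of modes (spin orbitals): the Hilbert
space whose orthonormal basis consists of the occupation number states `|S⟩`, `S ⊆ ι`. -/
abbrev Fock (ι : Type*) [Fintype ι] : Type _ := EuclideanSpace ℂ (Finset ι)

/-- Operators on Fock space; multiplication is composition. -/
abbrev FockOp (ι : Type*) [Fintype ι] : Type _ := Fock ι →L[ℂ] Fock ι

/-- The occupation number state `|S⟩`. -/
def occ (S : Finset ι) : Fock ι := EuclideanSpace.single S (1 : ℂ)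

/-- The operator that sends each occupation number state `|S⟩` to `f S`. -/
def opOfBasis (f : Finset ι → Fock ι) : FockOp ι :=
  LinearMap.toContinuousLinearMap
    ((EuclideanSpace.basisFun (Finset ι) ℂ).toBasis.constr ℂ f)

/-- The raising operator `a†_i`, with the Jordan-Wigner sign: it sends `|S⟩` to
`(-1)^{#{j ∈ S : j < i}} |S ∪ {i}⟩` if `i ∉ S`, and to `0` otherwise. -/
def create (i : ι) : FockOp ι :=
  opOfBasis fun S =>
    if i ∈ S then 0 else ((-1 : ℂ) ^ (S.filter (· < i)).card) • occ (insert i S)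

/-- The lowering operator `a_i`, the adjoint of `a†_i`. -/
def annihilate (i : ι) : FockOp ι := ContinuousLinearMap.adjoint (create i)

/-- The number operator `n_i = a†_i a_i`. -/
def number (i : ι) : FockOp ι := create i * annihilate i

variable (ι) in
/-- The manifold of states with exactly `η` particles. -/
def particleManifold (η : ℕ) : Set (Fock ι) :=
  {ψ | (∑ i : ι, number i) ψ = (η : ℂ) • ψ}

/-- Given new raising operators `b i`, the operator that sends
`|{i₁ < ⋯ < i_m}⟩ = a†_{i₁} ⋯ a†_{i_m} |∅⟩` to `b_{i₁} ⋯ b_{i_m} |∅⟩`. -/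
def slaterMap (b : ι → FockOp ι) : FockOp ι :=
  opOfBasis fun S => ((S.sort (· ≤ ·)).map b).prod (occ ∅)

/-- `e^{-i s A}` -/
def evolve (A : FockOp ι) (s : ℝ) : FockOp ι :=
  NormedSpace.exp ((-(Complex.I * (s : ℂ))) • A)

end Fock

/-- Labels of the `N = M ^ 3` plane waves, and of the `N` plane wave dual functions. -/
abbrev Site (M : ℕ) : Type := Fin 3 → Fin M

/-- Spin orbitals `(p, σ)`, in lexicographic order. -/
abbrev Mode (M : ℕ) : Type := Lex (Site M) ×ₗ Fin 2

variable {M : ℕ}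

/-- The spin orbital with label `p` and spin `σ`. -/
def mode (p : Site M) (σ : Fin 2) : Mode M := toLex (toLex p, σ)

/-- The integer vector `ν` with a given label; each component runs through the `M` consecutive
integers `-⌊M/2⌋, …, ⌈M/2⌉ - 1`. -/
def freq (ν : Site M) : Fin 3 → ℤ := fun i => ((ν i : ℕ) : ℤ) - ((M / 2 : ℕ) : ℤ)

/-- The plane wave frequency `k_ν = 2 π ν / Ω^{1/3}`. -/
def k (Ω : ℝ) (ν : Site M) : Fin 3 → ℝ := fun i => 2 * Real.pi * (freq ν i : ℝ) / Ω ^ (1 / 3 : ℝ)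

/-- `k_ν² = k_ν · k_ν` -/
def kSq (Ω : ℝ) (ν : Site M) : ℝ := k Ω ν ⬝ᵥ k Ω ν

/-- The lattice site `r_p = p (Ω / N)^{1/3}`, where `N = M ^ 3`. -/
def site (Ω : ℝ) (p : Site M) : Fin 3 → ℝ :=
  fun i => ((p i : ℕ) : ℝ) * (Ω / (M : ℝ) ^ 3) ^ (1 / 3 : ℝ)

variable (M) in
/-- The labels `ν` of the nonzero frequencies. -/
def nonzeroFreq : Finset (Site M) := Finset.univ.filter fun ν => freq ν ≠ 0

variable (M) in
/-- Kinetic operator in the plane wave dual basis,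
`T = (1 / 2N) ∑_{ν, p, q, σ} k_ν² cos[k_ν · (r_q - r_p)] a†_{p,σ} a_{q,σ}`. -/
def kinetic (Ω : ℝ) : FockOp (Mode M) :=
  ((1 / (2 * (M : ℝ) ^ 3) : ℝ) : ℂ) •
    ∑ ν : Site M, ∑ p : Site M, ∑ q : Site M, ∑ σ : Fin 2,
      ((kSq Ω ν * Real.cos (k Ω ν ⬝ᵥ (site Ω q - site Ω p)) : ℝ) : ℂ) •
        (create (mode p σ) * annihilate (mode q σ))

variable (M) in
/-- External potential of nuclei with charges `ζ j` at positions `R j`,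
`U = -(4π / Ω) ∑_{p, σ, j, ν ≠ 0} ζ_j cos[k_ν · (R_j - r_p)] / k_ν² n_{p,σ}`. -/
def external (Ω : ℝ) {J : ℕ} (ζ : Fin J → ℝ) (R : Fin J → Fin 3 → ℝ) : FockOp (Mode M) :=
  ((-(4 * Real.pi / Ω) : ℝ) : ℂ) •
    ∑ p : Site M, ∑ σ : Fin 2, ∑ j : Fin J, ∑ ν ∈ nonzeroFreq M,
      ((ζ j * Real.cos (k Ω ν ⬝ᵥ (R j - site Ω p)) / kSq Ω ν : ℝ) : ℂ) • number (mode p σ)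

variable (M) in
/-- Electron repulsion,
`V = (2π / Ω) ∑_{(p,σ) ≠ (q,σ'), ν ≠ 0} cos[k_ν · (r_p - r_q)] / k_ν² n_{p,σ} n_{q,σ'}`. -/
def repulsion (Ω : ℝ) : FockOp (Mode M) :=
  ((2 * Real.pi / Ω : ℝ) : ℂ) •
    ∑ p : Site M, ∑ σ : Fin 2, ∑ q : Site M, ∑ σ' : Fin 2,
      if (p, σ) = (q, σ') then 0 else
        ∑ ν ∈ nonzeroFreq M,
          ((Real.cos (k Ω ν ⬝ᵥ (site Ω p - site Ω q)) / kSq Ω ν : ℝ) : ℂ) •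
            (number (mode p σ) * number (mode q σ'))

/-- Plane wave raising operator `c†_{ν,σ} = N^{-1/2} ∑_p e^{-i k_ν · r_p} a†_{p,σ}`. -/
def planeWaveCreate (Ω : ℝ) (ν : Site M) (σ : Fin 2) : FockOp (Mode M) :=
  ((1 / Real.sqrt ((M : ℝ) ^ 3) : ℝ) : ℂ) •
    ∑ p : Site M,
      Complex.exp (-(Complex.I * ((k Ω ν ⬝ᵥ site Ω p : ℝ) : ℂ))) • create (mode p σ)

variable (M) in
/-- The fermionic fast Fourier transform: the unitary that fixes the vacuum and satisfies
`FFFT† a†_{ν,σ} FFFT = c†_{ν,σ}`. It is given through its adjoint, which sends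
`a†_{ν₁,σ₁} ⋯ a†_{ν_m,σ_m} |∅⟩` to `c†_{ν₁,σ₁} ⋯ c†_{ν_m,σ_m} |∅⟩`. (The volume `Ω` cancels in
`k_ν · r_p`.) -/
def FFFT (Ω : ℝ) : FockOp (Mode M) :=
  ContinuousLinearMap.adjoint
    (slaterMap fun m : Mode M => planeWaveCreate Ω (ofLex (ofLex m).1) (ofLex m).2)

variable (M) in
/-- The diagonal kinetic operator `(1 / 2) ∑_{ν, σ} k_ν² a†_{ν,σ} a_{ν,σ}`. -/
def kineticDiag (Ω : ℝ) : FockOp (Mode M) :=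
  ∑ ν : Site M, ∑ σ : Fin 2, ((kSq Ω ν / 2 : ℝ) : ℂ) • number (mode ν σ)

variable (M) in
/-- The Hamiltonian `H = T + U + V` in the plane wave dual basis. -/
def hamiltonian (Ω : ℝ) {J : ℕ} (ζ : Fin J → ℝ) (R : Fin J → Fin 3 → ℝ) : FockOp (Mode M) :=
  kinetic M Ω + external M Ω ζ R + repulsion M Ω

variable (M) in
/-- One step of length `τ` of the split-operator formula,
`e^{-i(U+V)τ/2} FFFT† e^{-i(τ/2) ∑ k_ν² a†_{ν,σ} a_{ν,σ}} FFFT e^{-i(U+V)τ/2}`. -/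
def splitStep (Ω : ℝ) {J : ℕ} (ζ : Fin J → ℝ) (R : Fin J → Fin 3 → ℝ) (τ : ℝ) :
    FockOp (Mode M) :=
  evolve (external M Ω ζ R + repulsion M Ω) (τ / 2) *
    ContinuousLinearMap.adjoint (FFFT M Ω) * evolve (kineticDiag M Ω) τ * FFFT M Ω *
      evolve (external M Ω ζ R + repulsion M Ω) (τ / 2)

/-- `η² N^{5/6} t^{3/2} / (Ω^{5/6} √ε) · √(1 + η Ω^{1/3} / N^{1/3})` -/
def stepScale (η N : ℕ) (Ω t ε : ℝ) : ℝ :=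
  (η : ℝ) ^ 2 * (N : ℝ) ^ (5 / 6 : ℝ) * t ^ (3 / 2 : ℝ) / (Ω ^ (5 / 6 : ℝ) * Real.sqrt ε) *
    Real.sqrt (1 + (η : ℝ) * Ω ^ (1 / 3 : ℝ) / (N : ℝ) ^ (1 / 3 : ℝ))

end PlaneWaveDual

end

/-!
The error bound is the commutator form of the Strang splitting error, restricted to the sector with
`η` electrons, combined with crude bounds on the kinetic and potential energies in that sector.

*Splitting.* Write `W = U + V`. Differentiating `e^{i(W+T)s} e^{-iWs/2} e^{-iTs} e^{-iWs/2}` in `s`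
leaves a difference of two conjugations whose first-order commutators cancel, so the local error is
`O(s³)` times double commutators (`norm_strang_sub_exp_le`), and local errors of unitaries add up
(`norm_pow_sub_pow_le`). A projection `P` that commutes with `W` and `T` can be absorbed into the
generators (`norm_splitStep_pow_sub_mul_proj_le`). With `a ≥ ‖W P‖` and `b ≥ ‖T P‖` the total error
is at most `t³ a b (a + b) / (3 r²)`. A term `a³` would violate the claimed scaling of `r`; it is
absent because every double commutator contains both `W` and `T`.

*Fourier transform.* The plane wave operators `c†_{ν,σ}` satisfy the canonical anticommutation
relations because the plane waves are orthonormal on the lattice. For any such family the map `F`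
that sends `|S⟩` to the corresponding Slater determinant satisfies `F a†_i = c†_i F` and
`F a_i = c_i F` (`slaterMap_mul_create`, `slaterMap_mul_annihilate`). Hence `F† F` commutes with all
`a†_i` and `a_i`, and it is the identity as it fixes the vacuum (`star_slaterMap_mul_slaterMap`).
Conjugation by `F = FFFT†` turns the diagonal kinetic operator into `T`
(`star_FFFT_mul_kineticDiag`): the sines drop out under `ν ↦ -ν` modulo `M`, which leaves `k_ν²`
unchanged.

*Energies.* With `L = Ω^{1/3}`, `k_ν² = O(M² / L²)` gives `b = O(η M² / L²)`. The Coulomb kernel is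
bounded by `∑_{ν ≠ 0} 1 / k_ν² = O(L² M)` (`sum_inv_sum_freq_sq_le`), so `a = O(η² M / L)`. Then
`a b (a + b) = O(η⁴ M⁵ / L⁵ (1 + η L / M))`, and with `N = M³` this times `t³ / ε` is the square of
the step scale (`stepScale_sq_mul`, `trotter_error_le`).
-/

namespace PlaneWaveDual

/-! ### The Strang splitting error in a Banach algebra -/

section Strang

open NormedSpace

variable {𝔸 : Type*} [NormedRing 𝔸]

theorem norm_mul_le_of_norm_le_one {X Y : 𝔸} (hX : ‖X‖ ≤ 1) : ‖X * Y‖ ≤ ‖Y‖ :=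
  (norm_mul_le X Y).trans (mul_le_of_le_one_left (norm_nonneg Y) hX)

theorem norm_mul_le_of_norm_le_one' {X Y : 𝔸} (hY : ‖Y‖ ≤ 1) : ‖X * Y‖ ≤ ‖X‖ :=
  (norm_mul_le X Y).trans (mul_le_of_le_one_right (norm_nonneg X) hY)

theorem norm_double_commutator_le (X Y : 𝔸) :
    ‖X * (X * Y - Y * X) - (X * Y - Y * X) * X‖ ≤ 4 * ‖X‖ ^ 2 * ‖Y‖ := by
  have h : ‖X * Y - Y * X‖ ≤ 2 * ‖X‖ * ‖Y‖ :=
    (norm_sub_le _ _).trans ((add_le_add (norm_mul_le _ _) (norm_mul_le _ _)).trans_eq (by ring))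
  calc ‖X * (X * Y - Y * X) - (X * Y - Y * X) * X‖
      ≤ 2 * ‖X‖ * ‖X * Y - Y * X‖ :=
        (norm_sub_le _ _).trans
          ((add_le_add (norm_mul_le _ _) (norm_mul_le _ _)).trans_eq (by ring))
    _ ≤ 2 * ‖X‖ * (2 * ‖X‖ * ‖Y‖) := by gcongr
    _ = _ := by ring

/-- Local errors of contractions add up at most linearly. -/
theorem norm_pow_sub_pow_le {X Y : 𝔸} (hX : ‖X‖ ≤ 1) (hY : ‖Y‖ ≤ 1) (n : ℕ) :
    ‖X ^ n - Y ^ n‖ ≤ n * ‖X - Y‖ := by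
  induction n with
  | zero => simp
  | succ n ih =>
    rcases Nat.eq_zero_or_pos n with rfl | hn
    · simp
    have hXn : ‖X ^ n‖ ≤ 1 := (norm_pow_le' X hn).trans (pow_le_one₀ (norm_nonneg _) hX)
    have e : X ^ (n + 1) - Y ^ (n + 1) = X ^ n * (X - Y) + (X ^ n - Y ^ n) * Y := by
      rw [pow_succ, pow_succ]; noncomm_ring
    rw [e]
    refine (norm_add_le _ _).trans ((add_le_add (norm_mul_le_of_norm_le_one hXn)
      ((norm_mul_le_of_norm_le_one' hY).trans ih)).trans_eq ?_)
    push_cast; ring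

variable [NormedAlgebra ℝ 𝔸]

theorem commute_exp_smul (X : 𝔸) (s : ℝ) : Commute (exp (s • X)) X :=
  ((Commute.refl X).smul_left s).exp_left

variable [CompleteSpace 𝔸]

theorem exp_smul_mul_exp_neg_smul (X : 𝔸) (s : ℝ) : exp (s • X) * exp (-(s • X)) = 1 := by
  let _ : NormedAlgebra ℚ 𝔸 := NormedAlgebra.restrictScalars ℚ ℝ 𝔸
  rw [← exp_add_of_commute (Commute.refl _).neg_right]
  simp

theorem exp_neg_smul_mul_exp_smul (X : 𝔸) (s : ℝ) : exp (-(s • X)) * exp (s • X) = 1 := by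
  let _ : NormedAlgebra ℚ 𝔸 := NormedAlgebra.restrictScalars ℚ ℝ 𝔸
  rw [← exp_add_of_commute (Commute.refl _).neg_left]
  simp

theorem hasDerivAt_exp_neg_smul (X : 𝔸) (s : ℝ) :
    HasDerivAt (fun u : ℝ => exp (-(u • X))) (-(X * exp (-(s • X)))) s := by
  simpa using hasDerivAt_exp_smul_const' (𝕂 := ℝ) (-X) s

theorem hasDerivAt_exp_conj (X Y : 𝔸) (s : ℝ) :
    HasDerivAt (fun u : ℝ => exp (u • X) * Y * exp (-(u • X)))
      (exp (s • X) * (X * Y - Y * X) * exp (-(s • X))) s := by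
  refine ((((hasDerivAt_exp_smul_const (𝕂 := ℝ) X s).mul_const Y).mul
    (hasDerivAt_exp_neg_smul X s))).congr_deriv ?_
  noncomm_ring

theorem norm_exp_conj_sub_le {X : 𝔸} (hX : ∀ s : ℝ, ‖exp (s • X)‖ ≤ 1) (Y : 𝔸) {s : ℝ}
    (hs : 0 ≤ s) :
    ‖exp (s • X) * Y * exp (-(s • X)) - Y‖ ≤ s * ‖X * Y - Y * X‖ := by
  have hX' : ∀ s : ℝ, ‖exp (-(s • X))‖ ≤ 1 := fun s => by simpa using hX (-s)
  have h := norm_image_sub_le_of_norm_deriv_le_segment' (a := 0) (b := s)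
    (f := fun u : ℝ => exp (u • X) * Y * exp (-(u • X))) (C := ‖X * Y - Y * X‖)
    (fun u _ => (hasDerivAt_exp_conj X Y u).hasDerivWithinAt)
    (fun u _ => (norm_mul_le_of_norm_le_one' (hX' u)).trans (norm_mul_le_of_norm_le_one (hX u)))
    s (Set.right_mem_Icc.2 hs)
  simpa [mul_comm] using h

/-- Second-order Taylor estimate for `e^{sX} Y e^{-sX}`, with the double commutator in the
remainder. -/
theorem norm_exp_conj_sub_sub_le {X : 𝔸} (hX : ∀ s : ℝ, ‖exp (s • X)‖ ≤ 1) (Y : 𝔸) {s : ℝ}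
    (hs : 0 ≤ s) :
    ‖exp (s • X) * Y * exp (-(s • X)) - Y - s • (X * Y - Y * X)‖ ≤
      s ^ 2 / 2 * ‖X * (X * Y - Y * X) - (X * Y - Y * X) * X‖ := by
  set Z := X * Y - Y * X with hZ
  have hd : ∀ u : ℝ, HasDerivAt (fun u : ℝ => exp (u • X) * Y * exp (-(u • X)) - Y - u • Z)
      (exp (u • X) * Z * exp (-(u • X)) - Z) u := fun u =>
    (((hasDerivAt_exp_conj X Y u).sub_const Y).sub
      ((hasDerivAt_id u).smul_const Z)).congr_deriv (by simp [hZ])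
  refine image_norm_le_of_norm_deriv_right_le_deriv_boundary (a := 0) (b := s)
    (f := fun u : ℝ => exp (u • X) * Y * exp (-(u • X)) - Y - u • Z)
    (f' := fun u => exp (u • X) * Z * exp (-(u • X)) - Z)
    (B := fun u => u ^ 2 / 2 * ‖X * Z - Z * X‖) (B' := fun u => u * ‖X * Z - Z * X‖)
    (fun u _ => (hd u).continuousAt.continuousWithinAt) (fun u _ => (hd u).hasDerivWithinAt)
    (by simp) (fun u => ?_) (fun u hu => norm_exp_conj_sub_le hX Z hu.1)
    (Set.right_mem_Icc.2 hs)
  refine (((hasDerivAt_pow 2 u).div_const 2).mul_const _).congr_deriv ?_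
  norm_num

/-- Local error of the symmetric splitting `e^{sX} e^{sY} e^{sX}` of `e^{s(X + Y + X)}`.
Differentiating `e^{-s(X + Y + X)} e^{sX} e^{sY} e^{sX}` leaves
`(Y - e^{-sX} Y e^{sX}) + (e^{sY} X e^{-sY} - X)` between contractions, and the two
first-order commutators cancel. -/
theorem norm_strang_sub_exp_le {X Y : 𝔸} (hX : ∀ s : ℝ, ‖exp (s • X)‖ ≤ 1)
    (hY : ∀ s : ℝ, ‖exp (s • Y)‖ ≤ 1) (hH : ∀ s : ℝ, ‖exp (s • (X + Y + X))‖ ≤ 1) {s : ℝ}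
    (hs : 0 ≤ s) :
    ‖exp (s • X) * exp (s • Y) * exp (s • X) - exp (s • (X + Y + X))‖ ≤
      s ^ 3 / 6 * (‖X * (X * Y - Y * X) - (X * Y - Y * X) * X‖ +
        ‖Y * (Y * X - X * Y) - (Y * X - X * Y) * Y‖) := by
  set H := X + Y + X with hHdef
  set K := ‖X * (X * Y - Y * X) - (X * Y - Y * X) * X‖ +
        ‖Y * (Y * X - X * Y) - (Y * X - X * Y) * Y‖ with hK
  have hX' : ∀ s : ℝ, ‖exp (s • -X)‖ ≤ 1 := fun s => by simpa using hX (-s)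
  have hH' : ∀ s : ℝ, ‖exp (-(s • H))‖ ≤ 1 := fun s => by simpa using hH (-s)
  let G : ℝ → 𝔸 := fun u => (Y - exp (-(u • X)) * Y * exp (u • X)) +
    (exp (u • Y) * X * exp (-(u • Y)) - X)
  have hG : ∀ u : ℝ, 0 ≤ u → ‖G u‖ ≤ u ^ 2 / 2 * K := by
    intro u hu
    have h1 := norm_exp_conj_sub_sub_le hX' Y hu
    have h2 := norm_exp_conj_sub_sub_le hY X hu
    have e1 : -X * (-X * Y - Y * -X) - (-X * Y - Y * -X) * -X =
        X * (X * Y - Y * X) - (X * Y - Y * X) * X := by noncomm_ring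
    rw [e1, smul_neg, neg_neg] at h1
    have e : G u = (exp (u • Y) * X * exp (-(u • Y)) - X - u • (Y * X - X * Y)) -
        (exp (-(u • X)) * Y * exp (u • X) - Y - u • (-X * Y - Y * -X)) := by
      simp only [G, smul_sub, neg_mul, mul_neg, smul_neg]
      abel
    rw [e]
    refine (norm_sub_le _ _).trans ((add_le_add h2 h1).trans (le_of_eq ?_))
    rw [hK]; ring
  have hd : ∀ u : ℝ, HasDerivAt
      (fun u : ℝ => exp (-(u • H)) * (exp (u • X) * exp (u • Y) * exp (u • X)) - 1)
      (exp (-(u • H)) * (exp (u • X) * (G u * (exp (u • Y) * exp (u • X))))) u := by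
    intro u
    refine (((hasDerivAt_exp_neg_smul H u).mul
      (((hasDerivAt_exp_smul_const' (𝕂 := ℝ) X u).mul
        (hasDerivAt_exp_smul_const' (𝕂 := ℝ) Y u)).mul
        (hasDerivAt_exp_smul_const' (𝕂 := ℝ) X u))).sub_const 1).congr_deriv ?_
    have c1 : exp (u • X) * X = X * exp (u • X) := commute_exp_smul X u
    have c2 : H * exp (-(u • H)) = exp (-(u • H)) * H := by
      simpa using (commute_exp_smul H (-u)).eq.symm
    have i1 : exp (u • X) * exp (-(u • X)) = 1 := exp_smul_mul_exp_neg_smul X u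
    have i2 : exp (-(u • Y)) * exp (u • Y) = 1 := exp_neg_smul_mul_exp_smul Y u
    simp only [G, Pi.mul_apply]
    rw [c2]
    generalize exp (-(u • X)) = x' at *
    generalize exp (-(u • Y)) = y' at *
    generalize exp (-(u • H)) = h' at *
    generalize exp (u • X) = x at *
    generalize exp (u • Y) = y at *
    have e1 : x * ((Y - x' * Y * x + (y * X * y' - X)) * (y * x)) =
        x * Y * y * x - (x * x') * Y * x * y * x + x * y * X * (y' * y) * x - x * X * y * x := by
      noncomm_ring
    rw [e1, i1, i2, c1, hHdef]
    noncomm_ring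
  have hmain := image_norm_le_of_norm_deriv_right_le_deriv_boundary (a := 0) (b := s)
    (f := fun u : ℝ => exp (-(u • H)) * (exp (u • X) * exp (u • Y) * exp (u • X)) - 1)
    (f' := fun u => exp (-(u • H)) * (exp (u • X) * (G u * (exp (u • Y) * exp (u • X)))))
    (B := fun u => u ^ 3 / 6 * K) (B' := fun u => u ^ 2 / 2 * K)
    (fun u _ => (hd u).continuousAt.continuousWithinAt) (fun u _ => (hd u).hasDerivWithinAt)
    (by simp)
    (fun u => (((hasDerivAt_pow 3 u).div_const 6).mul_const K).congr_deriv
      (by norm_num; ring_nf; simp))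
    (fun u hu => (norm_mul_le_of_norm_le_one (hH' u)).trans <|
      (norm_mul_le_of_norm_le_one (hX u)).trans <|
      (norm_mul_le_of_norm_le_one'
        ((norm_mul_le_of_norm_le_one (hY u)).trans (hX u))).trans (hG u hu.1))
    (Set.right_mem_Icc.2 hs)
  have e : exp (s • X) * exp (s • Y) * exp (s • X) - exp (s • H) =
      exp (s • H) * (exp (-(s • H)) * (exp (s • X) * exp (s • Y) * exp (s • X)) - 1) := by
    rw [mul_sub, ← mul_assoc (exp (s • H)), exp_smul_mul_exp_neg_smul, one_mul, mul_one]
  rw [e]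
  exact (norm_mul_le_of_norm_le_one (hH s)).trans hmain

end Strang

/-! ### Operators on Fock space in the occupation number basis -/

section FockSpace

variable {ι : Type*} [LinearOrder ι]

/-- The Jordan-Wigner sign of the mode `i` in the occupation number state `|S⟩`. -/
def jwSign (i : ι) (S : Finset ι) : ℂ := (-1) ^ (S.filter (· < i)).card

theorem jwSign_mul_self (i : ι) (S : Finset ι) : jwSign i S * jwSign i S = 1 := by
  rw [jwSign, ← mul_pow]; simp

theorem star_jwSign (i : ι) (S : Finset ι) : star (jwSign i S) = jwSign i S := by
  simp [jwSign]

theorem jwSign_insert_of_lt {i j : ι} {S : Finset ι} (h : j < i) (hj : j ∉ S) :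
    jwSign i (insert j S) = -jwSign i S := by
  rw [jwSign, jwSign, Finset.filter_insert, if_pos h, Finset.card_insert_of_notMem (by simp [hj]),
    pow_succ]
  ring

theorem jwSign_insert_of_le {i j : ι} (S : Finset ι) (h : i ≤ j) :
    jwSign i (insert j S) = jwSign i S := by
  rw [jwSign, jwSign, Finset.filter_insert, if_neg h.not_gt]

variable [Fintype ι]

theorem opOfBasis_occ (f : Finset ι → Fock ι) (S : Finset ι) : opOfBasis f (occ S) = f S := by
  have h : occ S = (EuclideanSpace.basisFun (Finset ι) ℂ).toBasis S := by
    simp [occ]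
  rw [opOfBasis, LinearMap.coe_toContinuousLinearMap', h, Module.Basis.constr_basis]

theorem fockOp_ext {X Y : FockOp ι} (h : ∀ S, X (occ S) = Y (occ S)) : X = Y := by
  apply ContinuousLinearMap.coe_injective
  refine (EuclideanSpace.basisFun (Finset ι) ℂ).toBasis.ext fun S => ?_
  simpa [occ] using h S

theorem inner_occ_left (S : Finset ι) (v : Fock ι) : ⟪occ S, v⟫_ℂ = v S := by
  simp [occ, EuclideanSpace.inner_single_left]

theorem occ_apply (S T : Finset ι) : (occ S : Fock ι) T = if T = S then 1 else 0 := by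
  simp [occ]

/-- The operator with eigenvalue `f S` on the occupation number state `|S⟩`. -/
noncomputable def diagOp (f : Finset ι → ℂ) : FockOp ι := opOfBasis fun S => f S • occ S

theorem diagOp_occ (f : Finset ι → ℂ) (S : Finset ι) : diagOp f (occ S) = f S • occ S :=
  opOfBasis_occ _ S

theorem diagOp_add (f g : Finset ι → ℂ) : diagOp (f + g) = diagOp f + diagOp g :=
  fockOp_ext fun S => by simp [diagOp_occ, add_smul]

theorem diagOp_smul (c : ℂ) (f : Finset ι → ℂ) : diagOp (c • f) = c • diagOp f :=
  fockOp_ext fun S => by simp [diagOp_occ, mul_smul]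

theorem diagOp_zero : diagOp (0 : Finset ι → ℂ) = 0 :=
  fockOp_ext fun S => by simp [diagOp_occ]

theorem diagOp_sum {κ : Type*} (s : Finset κ) (f : κ → Finset ι → ℂ) :
    diagOp (∑ x ∈ s, f x) = ∑ x ∈ s, diagOp (f x) := by
  classical
  induction s using Finset.induction_on with
  | empty => simp [diagOp_zero]
  | insert a s ha ih => rw [Finset.sum_insert ha, Finset.sum_insert ha, diagOp_add, ih]

theorem diagOp_mul (f g : Finset ι → ℂ) : diagOp f * diagOp g = diagOp (f * g) :=
  fockOp_ext fun S => by
    simp [diagOp_occ, smul_smul, mul_comm]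

theorem star_apply_coord (X : FockOp ι) (S T : Finset ι) :
    (star X (occ S)) T = star ((X (occ T)) S) := by
  rw [← inner_occ_left, ContinuousLinearMap.star_eq_adjoint,
    ContinuousLinearMap.adjoint_inner_right, ← inner_occ_left S, ← inner_conj_symm]
  rfl

theorem star_diagOp (f : Finset ι → ℂ) : star (diagOp f) = diagOp (star f) :=
  fockOp_ext fun S => by
    ext T
    rw [star_apply_coord, diagOp_occ, diagOp_occ]
    by_cases h : S = T
    · subst h; simp [occ_apply]
    · simp [occ_apply, h, Ne.symm h]

theorem diagOp_apply (f : Finset ι → ℂ) (v : Fock ι) (S : Finset ι) :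
    (diagOp f v) S = f S * v S := by
  rw [← inner_occ_left S (diagOp f v), ← star_star (diagOp f), ContinuousLinearMap.star_eq_adjoint,
    ContinuousLinearMap.adjoint_inner_right, star_diagOp, diagOp_occ, inner_smul_left,
    inner_occ_left]
  simp

theorem norm_diagOp_le {f : Finset ι → ℂ} {C : ℝ} (hC : 0 ≤ C) (hf : ∀ S, ‖f S‖ ≤ C) :
    ‖diagOp f‖ ≤ C := by
  refine ContinuousLinearMap.opNorm_le_bound _ hC fun v => ?_
  rw [← sq_le_sq₀ (norm_nonneg _) (by positivity), mul_pow, EuclideanSpace.norm_sq_eq,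
    EuclideanSpace.norm_sq_eq, Finset.mul_sum]
  refine Finset.sum_le_sum fun S _ => ?_
  rw [diagOp_apply, norm_mul, mul_pow]
  have := hf S
  gcongr

/-! ### Canonical anticommutation relations -/

theorem create_occ_of_mem {i : ι} {S : Finset ι} (h : i ∈ S) : create i (occ S) = 0 := by
  rw [create, opOfBasis_occ, if_pos h]

theorem create_occ_of_notMem {i : ι} {S : Finset ι} (h : i ∉ S) :
    create i (occ S) = jwSign i S • occ (insert i S) := by
  rw [create, opOfBasis_occ, if_neg h]; rfl

theorem annihilate_eq_star (i : ι) : annihilate i = star (create i) := rfl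

theorem annihilate_occ_of_notMem {i : ι} {S : Finset ι} (h : i ∉ S) :
    annihilate i (occ S) = 0 := by
  ext T
  rw [annihilate_eq_star, star_apply_coord]
  by_cases hT : i ∈ T
  · simp [create_occ_of_mem hT]
  · have : S ≠ insert i T := fun e => h (e ▸ Finset.mem_insert_self i T)
    simp [create_occ_of_notMem hT, occ_apply, this]

theorem annihilate_occ_insert {i : ι} {S : Finset ι} (h : i ∉ S) :
    annihilate i (occ (insert i S)) = jwSign i S • occ S := by
  ext T
  rw [annihilate_eq_star, star_apply_coord]
  by_cases hT : i ∈ T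
  · have : T ≠ S := fun e => h (e ▸ hT)
    simp [create_occ_of_mem hT, occ_apply, this]
  · by_cases e : T = S
    · subst e
      simpa [create_occ_of_notMem hT, occ_apply] using star_jwSign i T
    · have : insert i S ≠ insert i T := fun e' => e <| by
        rw [← Finset.erase_insert hT, ← e', Finset.erase_insert h]
      simp [create_occ_of_notMem hT, occ_apply, e, this]

theorem create_mul_create (i j : ι) : create i * create j + create j * create i = 0 := by
  wlog hij : i ≤ j generalizing i j
  · rw [add_comm]; exact this j i (le_of_not_ge hij)
  refine fockOp_ext fun S => ?_
  simp only [add_apply, mul_apply_eq_comp,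
    zero_apply]
  by_cases hi : i ∈ S
  · by_cases hj : j ∈ S
    · simp [create_occ_of_mem hi, create_occ_of_mem hj]
    · simp [create_occ_of_mem hi, create_occ_of_notMem hj,
        create_occ_of_mem (Finset.mem_insert_of_mem hi)]
  · by_cases hj : j ∈ S
    · simp [create_occ_of_notMem hi, create_occ_of_mem hj,
        create_occ_of_mem (Finset.mem_insert_of_mem hj)]
    · rcases hij.eq_or_lt with rfl | hlt
      · simp [create_occ_of_notMem hi, create_occ_of_mem (Finset.mem_insert_self i S)]
      · have h1 : i ∉ insert j S := by simp [hi, hlt.ne]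
        have h2 : j ∉ insert i S := by simp [hj, hlt.ne']
        rw [create_occ_of_notMem hi, create_occ_of_notMem hj, map_smul, map_smul,
          create_occ_of_notMem h1, create_occ_of_notMem h2, jwSign_insert_of_lt hlt hi,
          jwSign_insert_of_le S hlt.le, Finset.insert_comm, smul_smul, smul_smul, ← add_smul]
        convert zero_smul ℂ _ using 2
        ring

theorem annihilate_mul_create (i j : ι) :
    annihilate i * create j + create j * annihilate i = if i = j then 1 else 0 := by
  refine fockOp_ext fun S => ?_
  simp only [add_apply, mul_apply_eq_comp]
  by_cases hi : i ∈ S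
  · obtain ⟨T, hT, rfl⟩ : ∃ T, i ∉ T ∧ insert i T = S :=
      ⟨S.erase i, Finset.notMem_erase i S, Finset.insert_erase hi⟩
    rw [annihilate_occ_insert hT]
    rcases lt_trichotomy i j with hlt | rfl | hlt
    · by_cases hj : j ∈ T
      · simp [create_occ_of_mem hj, create_occ_of_mem (Finset.mem_insert_of_mem hj), hlt.ne]
      · have h2 : j ∉ insert i T := by simp [hj, hlt.ne']
        have h3 : i ∉ insert j T := by simp [hT, hlt.ne]
        rw [create_occ_of_notMem h2, Finset.insert_comm, map_smul, annihilate_occ_insert h3,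
          map_smul, create_occ_of_notMem hj, smul_smul, smul_smul, ← add_smul,
          jwSign_insert_of_lt hlt hT, jwSign_insert_of_le T hlt.le, if_neg hlt.ne, zero_apply]
        convert zero_smul ℂ _ using 2
        ring
    · simp [create_occ_of_mem (Finset.mem_insert_self i T), create_occ_of_notMem hT, smul_smul,
        jwSign_mul_self]
    · by_cases hj : j ∈ T
      · simp [create_occ_of_mem hj, create_occ_of_mem (Finset.mem_insert_of_mem hj), hlt.ne']
      · have h2 : j ∉ insert i T := by simp [hj, hlt.ne]
        have h3 : i ∉ insert j T := by simp [hT, hlt.ne']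
        rw [create_occ_of_notMem h2, Finset.insert_comm, map_smul, annihilate_occ_insert h3,
          map_smul, create_occ_of_notMem hj, smul_smul, smul_smul, ← add_smul,
          jwSign_insert_of_lt hlt hj, jwSign_insert_of_le T hlt.le, if_neg hlt.ne', zero_apply]
        convert zero_smul ℂ _ using 2
        ring
  · rw [annihilate_occ_of_notMem hi, map_zero, add_zero]
    by_cases hj : j ∈ S
    · have : i ≠ j := fun e => hi (e ▸ hj)
      simp [create_occ_of_mem hj, this]
    · rw [create_occ_of_notMem hj, map_smul]
      by_cases e : i = j
      · subst e
        simp [annihilate_occ_insert hi, smul_smul, jwSign_mul_self]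
      · rw [annihilate_occ_of_notMem (by simp [hi, e])]
        simp [e]

theorem number_eq_diagOp (i : ι) : number i = diagOp fun S => if i ∈ S then 1 else 0 := by
  refine fockOp_ext fun S => ?_
  rw [number, mul_apply_eq_comp, diagOp_occ]
  by_cases hi : i ∈ S
  · obtain ⟨T, hT, rfl⟩ : ∃ T, i ∉ T ∧ insert i T = S :=
      ⟨S.erase i, Finset.notMem_erase i S, Finset.insert_erase hi⟩
    simp [annihilate_occ_insert hT, create_occ_of_notMem hT, smul_smul, jwSign_mul_self]
  · simp [annihilate_occ_of_notMem hi, hi]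

theorem sum_number_eq_diagOp : ∑ i : ι, number i = diagOp fun S => (S.card : ℂ) := by
  simp only [number_eq_diagOp]
  rw [← diagOp_sum]
  congr 1
  ext S
  simp

theorem sum_number_mul_create (i : ι) :
    (∑ j : ι, number j) * create i = create i * ∑ j : ι, number j + create i := by
  rw [sum_number_eq_diagOp]
  refine fockOp_ext fun S => ?_
  simp only [add_apply, mul_apply_eq_comp, diagOp_occ, map_smul]
  by_cases hi : i ∈ S
  · simp [create_occ_of_mem hi]
  · rw [create_occ_of_notMem hi, map_smul, diagOp_occ, Finset.card_insert_of_notMem hi]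
    push_cast
    module

/-- An operator that commutes with the particle number preserves every particle number sector. -/
theorem commute_diagOp_card {X : FockOp ι} (h : Commute (∑ i : ι, number i) X) (g : ℕ → ℂ) :
    Commute (diagOp fun S => g S.card) X := by
  refine fockOp_ext fun S => ?_
  ext T
  have h1 := congrArg (fun Y : FockOp ι => Y (occ S) T) h.eq
  simp only [sum_number_eq_diagOp, mul_apply_eq_comp, diagOp_occ, diagOp_apply,
    map_smul, PiLp.smul_apply, smul_eq_mul] at h1 ⊢
  by_cases e : T.card = S.card
  · rw [e]
  · have : ((T.card : ℂ) - S.card) * X (occ S) T = 0 := by rw [sub_mul, h1, sub_self]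
    rcases mul_eq_zero.1 this with h2 | h2
    · exact absurd (by exact_mod_cast sub_eq_zero.1 h2) e
    · rw [h2, mul_zero, mul_zero]

variable (ι) in
/-- The orthogonal projection onto the sector with `η` particles. -/
noncomputable def sectorProj (η : ℕ) : FockOp ι := diagOp fun S => if S.card = η then 1 else 0

theorem commute_sectorProj {X : FockOp ι} (h : Commute (∑ i : ι, number i) X) (η : ℕ) :
    Commute (sectorProj ι η) X :=
  commute_diagOp_card h fun n => if n = η then 1 else 0

theorem commute_sectorProj_diagOp (η : ℕ) (f : Finset ι → ℂ) :
    Commute (sectorProj ι η) (diagOp f) := by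
  rw [Commute, SemiconjBy, sectorProj, diagOp_mul, diagOp_mul, mul_comm]

theorem sectorProj_mul_self (η : ℕ) : sectorProj ι η * sectorProj ι η = sectorProj ι η := by
  rw [sectorProj, diagOp_mul]
  congr 1
  ext S
  simp

theorem star_sectorProj (η : ℕ) : star (sectorProj ι η) = sectorProj ι η := by
  rw [sectorProj, star_diagOp]
  congr 1
  ext S
  by_cases h : S.card = η <;> simp [h]

theorem sectorProj_apply_of_mem {η : ℕ} {ψ : Fock ι} (h : ψ ∈ particleManifold ι η) :
    sectorProj ι η ψ = ψ := by
  ext S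
  have h1 : (∑ i : ι, number i) ψ = (η : ℂ) • ψ := h
  have h2 := congrArg (fun v : Fock ι => v S) h1
  simp only [sum_number_eq_diagOp, diagOp_apply, PiLp.smul_apply, smul_eq_mul] at h2
  rw [sectorProj, diagOp_apply]
  by_cases e : S.card = η
  · simp [e]
  · have : ((S.card : ℂ) - η) * ψ S = 0 := by rw [sub_mul, h2, sub_self]
    rcases mul_eq_zero.1 this with h3 | h3
    · exact absurd (by exact_mod_cast sub_eq_zero.1 h3) e
    · rw [h3, mul_zero]

theorem norm_diagOp_mul_sectorProj_le {f : Finset ι → ℂ} {η : ℕ} {C : ℝ} (hC : 0 ≤ C)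
    (hf : ∀ S : Finset ι, S.card = η → ‖f S‖ ≤ C) : ‖diagOp f * sectorProj ι η‖ ≤ C := by
  rw [sectorProj, diagOp_mul]
  refine norm_diagOp_le hC fun S => ?_
  by_cases h : S.card = η
  · simpa [h] using hf S h
  · simpa [h] using hC

/-! ### The Slater map of a family of raising operators -/

section Slater

variable {b : ι → FockOp ι}

theorem slaterMap_occ_empty (b : ι → FockOp ι) : slaterMap b (occ ∅) = occ ∅ := by
  rw [slaterMap, opOfBasis_occ]; simp

theorem slaterMap_occ_insert (b : ι → FockOp ι) {i : ι} {S : Finset ι} (h : ∀ j ∈ S, i < j) :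
    slaterMap b (occ (insert i S)) = b i (slaterMap b (occ S)) := by
  rw [slaterMap, opOfBasis_occ, opOfBasis_occ,
    Finset.sort_insert (r := (· ≤ ·)) (fun j hj => (h j hj).le) (fun hi => (h i hi).false)]
  simp

theorem create_occ_of_lt {i : ι} {S : Finset ι} (h : ∀ j ∈ S, i < j) :
    create i (occ S) = occ (insert i S) := by
  rw [create_occ_of_notMem fun hi => (h i hi).false, jwSign,
    Finset.filter_false_of_mem fun j hj => (h j hj).not_gt]
  simp

/-- Two operators that agree on the vacuum, and on `a†_i |S⟩` for `i` below all of `S` as soon as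
they agree on `|S⟩`, are equal. -/
theorem fockOp_ext_of_create {X Y : FockOp ι} (h0 : X (occ ∅) = Y (occ ∅))
    (h : ∀ (i : ι) (S : Finset ι), (∀ j ∈ S, i < j) → X (occ S) = Y (occ S) →
      X (create i (occ S)) = Y (create i (occ S))) : X = Y := by
  refine fockOp_ext fun S => ?_
  induction S using Finset.induction_on_min with
  | empty => exact h0
  | insert i S hi ih => rw [← create_occ_of_lt hi]; exact h i S hi ih

/-- For `i` below all of `S` the identity holds on `|S⟩` by the definition of the Slater map. In
general, anticommutation moves `a†_i` and `b_i` past the smallest mode of `S`. -/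
theorem slaterMap_mul_create (hb : ∀ i j, b i * b j + b j * b i = 0) (i : ι) :
    slaterMap b * create i = b i * slaterMap b := by
  have hmin : ∀ (i : ι) (S : Finset ι), (∀ j ∈ S, i < j) →
      slaterMap b (create i (occ S)) = b i (slaterMap b (occ S)) := fun i S h => by
    rw [create_occ_of_lt h, slaterMap_occ_insert b h]
  have anti : ∀ (i j : ι) (v : Fock ι), b i (b j v) = -b j (b i v) := fun i j v =>
    eq_neg_of_add_eq_zero_left (congrArg (fun Y : FockOp ι => Y v) (hb i j))
  have anti' : ∀ (i j : ι) (v : Fock ι), create i (create j v) = -create j (create i v) :=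
    fun i j v =>
      eq_neg_of_add_eq_zero_left (congrArg (fun Y : FockOp ι => Y v) (create_mul_create i j))
  have add_self : ∀ {v : Fock ι}, v + v = 0 → v = 0 := fun {v} h => by
    rw [← two_smul ℂ] at h
    exact (smul_eq_zero.1 h).resolve_left two_ne_zero
  have sq : ∀ (v : Fock ι), b i (b i v) = 0 := fun v =>
    add_self (congrArg (fun Y : FockOp ι => Y v) (hb i i))
  have sq' : ∀ (v : Fock ι), create i (create i v) = 0 := fun v =>
    add_self (congrArg (fun Y : FockOp ι => Y v) (create_mul_create i i))
  refine fockOp_ext_of_create (hmin i ∅ (by simp)) fun m S hm ih => ?_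
  simp only [mul_apply_eq_comp] at ih ⊢
  rcases lt_trichotomy i m with hlt | rfl | hlt
  · rw [create_occ_of_lt hm]
    refine hmin i _ fun j hj => ?_
    rcases Finset.mem_insert.1 hj with rfl | hj
    · exact hlt
    · exact hlt.trans (hm j hj)
  · rw [sq', hmin i S hm, sq, map_zero]
  · rw [anti', map_neg, hmin m S hm, anti, ← ih]
    congr 1
    by_cases hi : i ∈ S
    · simp [create_occ_of_mem hi]
    · rw [create_occ_of_notMem hi, map_smul, map_smul, map_smul, map_smul, hmin]
      intro j hj
      rcases Finset.mem_insert.1 hj with rfl | hj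
      · exact hlt
      · exact hm j hj

theorem slaterMap_mul_annihilate (hb : ∀ i j, b i * b j + b j * b i = 0)
    (hb' : ∀ i j, star (b i) * b j + b j * star (b i) = if i = j then 1 else 0)
    (hvac : ∀ i, star (b i) (occ ∅) = 0) (i : ι) :
    slaterMap b * annihilate i = star (b i) * slaterMap b := by
  have hc : ∀ m v, slaterMap b (create m v) = b m (slaterMap b v) := fun m v =>
    congrArg (fun Y : FockOp ι => Y v) (slaterMap_mul_create hb m)
  refine fockOp_ext_of_create ?_ fun m S hm ih => ?_
  · simp [annihilate_occ_of_notMem, slaterMap_occ_empty, hvac]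
  · have h1 : annihilate i (create m (occ S)) + create m (annihilate i (occ S)) =
        (if i = m then 1 else 0 : FockOp ι) (occ S) :=
      congrArg (fun Y : FockOp ι => Y (occ S)) (annihilate_mul_create i m)
    have h2 : star (b i) (b m (slaterMap b (occ S))) + b m (star (b i) (slaterMap b (occ S))) =
        (if i = m then 1 else 0 : FockOp ι) (slaterMap b (occ S)) :=
      congrArg (fun Y : FockOp ι => Y (slaterMap b (occ S))) (hb' i m)
    simp only [mul_apply_eq_comp] at ih ⊢
    rw [hc, eq_sub_of_add_eq h1, eq_sub_of_add_eq h2, map_sub, hc, ih]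
    congr 1
    split_ifs <;> simp

/-- The Slater map of a family that satisfies the canonical anticommutation relations is an
isometry: `F†F` commutes with all raising and lowering operators, hence is determined by its
action on the vacuum. -/
theorem star_slaterMap_mul_slaterMap (hb : ∀ i j, b i * b j + b j * b i = 0)
    (hb' : ∀ i j, star (b i) * b j + b j * star (b i) = if i = j then 1 else 0)
    (hvac : ∀ i, star (b i) (occ ∅) = 0) :
    star (slaterMap b) * slaterMap b = 1 := by
  set F := slaterMap b with hF
  have hc : ∀ i, F * create i = b i * F := slaterMap_mul_create hb
  have ha : ∀ i, F * star (create i) = star (b i) * F := slaterMap_mul_annihilate hb hb' hvac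
  have hc' : ∀ i, star F * star (b i) = star (create i) * star F := fun i => by
    rw [← star_mul, ← hc, star_mul]
  have ha' : ∀ i, star F * b i = create i * star F := fun i => by
    have := congrArg star (ha i)
    rw [star_mul, star_mul, star_star, star_star] at this
    exact this.symm
  have kc : ∀ i, star F * F * create i = create i * (star F * F) := fun i => by
    rw [mul_assoc, hc, ← mul_assoc, ha', mul_assoc]
  have ka : ∀ i, star F * F * star (create i) = star (create i) * (star F * F) := fun i => by
    rw [mul_assoc, ha, ← mul_assoc, hc', mul_assoc]
  refine fockOp_ext_of_create ?_ fun i S _ ih => ?_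
  · -- `⟨T|F†F|∅⟩ = 0` for nonempty `T`: the least `a_i`, `i ∈ T`, commutes with `F†F` and
    -- annihilates the vacuum
    ext T
    induction T using Finset.induction_on_min with
    | empty =>
      rw [mul_apply_eq_comp, ← inner_occ_left, ContinuousLinearMap.star_eq_adjoint,
        ContinuousLinearMap.adjoint_inner_right, hF, slaterMap_occ_empty, inner_occ_left]
      rfl
    | insert i T hi _ =>
      rw [← inner_occ_left, ← create_occ_of_lt hi, ← ContinuousLinearMap.adjoint_inner_right]
      have := congrArg (fun Y : FockOp ι => Y (occ ∅)) (ka i)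
      simp only [mul_apply_eq_comp, ← annihilate_eq_star,
        annihilate_occ_of_notMem (Finset.notMem_empty i), map_zero] at this
      rw [mul_apply_eq_comp]
      change ⟪occ T, annihilate i (star F (F (occ ∅)))⟫_ℂ = _
      rw [← this, inner_zero_right]
      simp [occ_apply]
  · have := congrArg (fun Y : FockOp ι => Y (occ S)) (kc i)
    simp only [mul_apply_eq_comp] at this ih ⊢
    rw [this, ih]
    rfl

theorem slaterMap_mul_star_slaterMap (hb : ∀ i j, b i * b j + b j * b i = 0)
    (hb' : ∀ i j, star (b i) * b j + b j * star (b i) = if i = j then 1 else 0)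
    (hvac : ∀ i, star (b i) (occ ∅) = 0) :
    slaterMap b * star (slaterMap b) = 1 := by
  have h := star_slaterMap_mul_slaterMap hb hb' hvac
  have h' : (star (slaterMap b)).toLinearMap * (slaterMap b).toLinearMap = 1 :=
    congrArg ContinuousLinearMap.toLinearMap h
  exact ContinuousLinearMap.coe_injective (mul_eq_one_comm.1 h')

theorem commute_sum_number_slaterMap
    (hN : ∀ i, (∑ j : ι, number j) * b i = b i * ∑ j : ι, number j + b i) :
    Commute (∑ j : ι, number j) (slaterMap b) := by
  refine fockOp_ext_of_create ?_ fun i S hi ih => ?_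
  · simp [slaterMap_occ_empty, sum_number_eq_diagOp, diagOp_occ]
  · have h1 := congrArg (fun Y : FockOp ι => Y (slaterMap b (occ S))) (hN i)
    have h2 := congrArg (fun Y : FockOp ι => Y (occ S)) (sum_number_mul_create i)
    simp only [mul_apply_eq_comp, add_apply] at ih h1 h2 ⊢
    rw [h2, map_add, create_occ_of_lt hi, slaterMap_occ_insert b hi, h1, ih]
    congr 1
    rw [sum_number_eq_diagOp, diagOp_occ, map_smul, map_smul, map_smul, map_smul,
      create_occ_of_lt hi, slaterMap_occ_insert b hi]

end Slater

end FockSpace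

/-! ### Linear changes of fermionic modes in a star algebra -/

section LinearCombinations

variable {𝔸 : Type*} [Ring 𝔸] [Algebra ℂ 𝔸] {ι : Type*} [Fintype ι]

theorem mul_sum_smul_of_ladder {c : ι → 𝔸} {N : 𝔸} (hN : ∀ i, N * c i = c i * N + c i)
    (f : ι → ℂ) :
    N * (∑ i, f i • c i) = (∑ i, f i • c i) * N + ∑ i, f i • c i := by
  rw [Finset.mul_sum, Finset.sum_mul, ← Finset.sum_add_distrib]
  refine Finset.sum_congr rfl fun i _ => ?_
  rw [mul_smul_comm, hN, smul_add, smul_mul_assoc]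

variable [StarRing 𝔸] [StarModule ℂ 𝔸]

theorem star_sum_smul (c : ι → 𝔸) (f : ι → ℂ) :
    star (∑ i, f i • c i) = ∑ i, (starRingEnd ℂ) (f i) • star (c i) := by
  simp [star_sum]

/-- If `F` intertwines the occupation number `n_{ν,σ}` with that of the mode `∑ p, w ν p c_{p,σ}`,
then it intertwines `∑ e_ν n_{ν,σ}` with the quadratic operator with matrix
`∑ ν, e_ν w_{νp} w̄_{νq}`. -/
theorem mul_sum_smul_of_intertwine {s : Type*} [Fintype s] {F : 𝔸} {c n : ι → s → 𝔸}
    {w : ι → ι → ℂ} (hF : ∀ ν σ, F * n ν σ =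
      (∑ p, w ν p • c p σ) * star (∑ p, w ν p • c p σ) * F)
    {e : ι → ℂ} {a : ℂ} {d : ι → ι → ι → ℂ}
    (hw : ∀ p q, ∑ ν, e ν * (w ν p * (starRingEnd ℂ) (w ν q)) = a * ∑ ν, d ν p q) :
    F * ∑ ν, ∑ σ, e ν • n ν σ =
      (a • ∑ ν, ∑ p, ∑ q, ∑ σ, d ν p q • (c p σ * star (c q σ))) * F := by
  have h1 : ∀ ν σ, F * (e ν • n ν σ) =
      (∑ p, ∑ q, (e ν * (w ν p * (starRingEnd ℂ) (w ν q))) • (c p σ * star (c q σ))) * F := by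
    intro ν σ
    rw [mul_smul_comm, hF, star_sum_smul, ← smul_mul_assoc, Finset.sum_mul_sum]
    simp only [Finset.smul_sum, smul_mul_smul_comm, smul_smul]
  simp only [Finset.mul_sum, h1]
  simp only [← Finset.sum_mul]
  congr 1
  have h2 : ∀ σ, ∑ ν, ∑ p, ∑ q, (e ν * (w ν p * (starRingEnd ℂ) (w ν q))) • (c p σ * star (c q σ)) =
      ∑ p, ∑ q, (a * ∑ ν, d ν p q) • (c p σ * star (c q σ)) := by
    intro σ
    rw [Finset.sum_comm]
    refine Finset.sum_congr rfl fun p _ => ?_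
    rw [Finset.sum_comm]
    refine Finset.sum_congr rfl fun q _ => ?_
    rw [← Finset.sum_smul, hw]
  rw [Finset.sum_comm, Finset.sum_congr rfl fun σ _ => h2 σ]
  simp only [Finset.smul_sum, Finset.mul_sum, Finset.sum_smul, smul_smul]
  calc _ = ∑ p, ∑ σ, ∑ q, ∑ ν, (a * d ν p q) • (c p σ * star (c q σ)) := Finset.sum_comm
    _ = ∑ p, ∑ q, ∑ ν, ∑ σ, (a * d ν p q) • (c p σ * star (c q σ)) := by
        refine Finset.sum_congr rfl fun p _ => ?_
        rw [Finset.sum_comm]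
        exact Finset.sum_congr rfl fun q _ => Finset.sum_comm
    _ = ∑ p, ∑ ν, ∑ q, ∑ σ, (a * d ν p q) • (c p σ * star (c q σ)) :=
        Finset.sum_congr rfl fun p _ => Finset.sum_comm
    _ = _ := Finset.sum_comm

end LinearCombinations

/-! ### Raising operators of one-particle states -/

section CreateVec

variable {ι : Type*} [LinearOrder ι] [Fintype ι]

/-- The raising operator `∑ i, f i a†_i` of the one-particle state with amplitudes `f`. -/
noncomputable def createVec (f : ι → ℂ) : FockOp ι := ∑ i, f i • create i

theorem star_createVec (f : ι → ℂ) :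
    star (createVec f) = ∑ i, (starRingEnd ℂ) (f i) • annihilate i := star_sum_smul _ _

theorem star_createVec_vacuum (f : ι → ℂ) : star (createVec f) (occ ∅) = 0 := by
  simp [star_createVec, sum_apply, annihilate_occ_of_notMem]

theorem createVec_anticomm (f g : ι → ℂ) :
    createVec f * createVec g + createVec g * createVec f = 0 := by
  have h : createVec g * createVec f = ∑ i, ∑ j, (f i * g j) • (create j * create i) := by
    rw [createVec, createVec, Finset.sum_mul_sum, Finset.sum_comm]
    simp only [smul_mul_smul_comm, mul_comm]
  rw [h, createVec, createVec, Finset.sum_mul_sum, ← Finset.sum_add_distrib]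
  refine Finset.sum_eq_zero fun i _ => ?_
  rw [← Finset.sum_add_distrib]
  refine Finset.sum_eq_zero fun j _ => ?_
  rw [smul_mul_smul_comm]
  refine (smul_add (f i * g j) (create i * create j) (create j * create i)).symm.trans ?_
  rw [create_mul_create]
  exact smul_zero (A := FockOp ι) (f i * g j)

theorem star_createVec_anticomm (f g : ι → ℂ) :
    star (createVec f) * createVec g + createVec g * star (createVec f) =
      (∑ i, (starRingEnd ℂ) (f i) * g i) • 1 := by
  have h : createVec g * (∑ i, (starRingEnd ℂ) (f i) • annihilate i) =
      ∑ i, ∑ j, ((starRingEnd ℂ) (f i) * g j) • (create j * annihilate i) := by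
    rw [createVec, Finset.sum_mul_sum, Finset.sum_comm]
    simp only [smul_mul_smul_comm, mul_comm]
  have h2 : ∀ i j, ((starRingEnd ℂ) (f i) • annihilate i) * (g j • create j) +
      ((starRingEnd ℂ) (f i) * g j) • (create j * annihilate i) =
      ((starRingEnd ℂ) (f i) * g j) • (if i = j then 1 else 0 : FockOp ι) := by
    intro i j
    rw [smul_mul_smul_comm, ← annihilate_mul_create]
    exact (smul_add _ (annihilate i * create j) (create j * annihilate i)).symm
  rw [star_createVec, h, createVec, Finset.sum_mul_sum, ← Finset.sum_add_distrib]
  refine Eq.trans ?_ (Finset.sum_smul (f := fun i => (starRingEnd ℂ) (f i) * g i)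
    (x := (1 : FockOp ι)) (s := Finset.univ)).symm
  refine Finset.sum_congr rfl fun i _ => ?_
  rw [← Finset.sum_add_distrib, Finset.sum_congr rfl fun j _ => h2 i j, Finset.sum_eq_single i]
  · rw [if_pos rfl]
  · intro j _ hj
    rw [if_neg hj.symm]
    exact smul_zero (A := FockOp ι) ((starRingEnd ℂ) (f i) * g j)
  · intro hi
    exact absurd (Finset.mem_univ i) hi

theorem sum_number_mul_createVec (f : ι → ℂ) :
    (∑ j : ι, number j) * createVec f = createVec f * (∑ j : ι, number j) + createVec f :=
  mul_sum_smul_of_ladder (c := create) sum_number_mul_create f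

theorem commute_sum_number_slaterMap_createVec (u : ι → ι → ℂ) :
    Commute (∑ i : ι, number i) (slaterMap fun i => createVec (u i)) :=
  commute_sum_number_slaterMap fun i => sum_number_mul_createVec (u i)

variable {u : ι → ι → ℂ}

theorem star_createVec_anticomm_of_orthonormal (hu₁ : ∀ i, ∑ m, (starRingEnd ℂ) (u i m) * u i m = 1)
    (hu₀ : ∀ i j, i ≠ j → ∑ m, (starRingEnd ℂ) (u i m) * u j m = 0) (i j : ι) :
    star (createVec (u i)) * createVec (u j) + createVec (u j) * star (createVec (u i)) =
      if i = j then 1 else 0 := by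
  rw [star_createVec_anticomm]
  split_ifs with h
  · rw [← h, hu₁]
    exact one_smul ℂ (1 : FockOp ι)
  · rw [hu₀ i j h]
    exact zero_smul ℂ (1 : FockOp ι)

theorem star_slaterMap_createVec_mul_self (hu₁ : ∀ i, ∑ m, (starRingEnd ℂ) (u i m) * u i m = 1)
    (hu₀ : ∀ i j, i ≠ j → ∑ m, (starRingEnd ℂ) (u i m) * u j m = 0) :
    star (slaterMap fun i => createVec (u i)) * slaterMap (fun i => createVec (u i)) = 1 :=
  star_slaterMap_mul_slaterMap (fun _ _ => createVec_anticomm _ _)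
    (star_createVec_anticomm_of_orthonormal hu₁ hu₀) fun _ => star_createVec_vacuum _

theorem slaterMap_createVec_mul_star_self (hu₁ : ∀ i, ∑ m, (starRingEnd ℂ) (u i m) * u i m = 1)
    (hu₀ : ∀ i j, i ≠ j → ∑ m, (starRingEnd ℂ) (u i m) * u j m = 0) :
    slaterMap (fun i => createVec (u i)) * star (slaterMap fun i => createVec (u i)) = 1 :=
  slaterMap_mul_star_slaterMap (fun _ _ => createVec_anticomm _ _)
    (star_createVec_anticomm_of_orthonormal hu₁ hu₀) fun _ => star_createVec_vacuum _

theorem slaterMap_createVec_mul_number (hu₁ : ∀ i, ∑ m, (starRingEnd ℂ) (u i m) * u i m = 1)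
    (hu₀ : ∀ i j, i ≠ j → ∑ m, (starRingEnd ℂ) (u i m) * u j m = 0) (i : ι) :
    slaterMap (fun i => createVec (u i)) * number i =
      createVec (u i) * star (createVec (u i)) * slaterMap fun i => createVec (u i) := by
  rw [number, ← mul_assoc, slaterMap_mul_create fun _ _ => createVec_anticomm _ _, mul_assoc,
    slaterMap_mul_annihilate (fun _ _ => createVec_anticomm _ _)
      (star_createVec_anticomm_of_orthonormal hu₁ hu₀) fun _ => star_createVec_vacuum _, mul_assoc]

end CreateVec

/-! ### Discrete Fourier analysis of the plane waves -/

variable {M : ℕ}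

theorem sum_mode {β : Type*} [AddCommMonoid β] (f : Mode M → β) :
    ∑ m, f m = ∑ p, ∑ σ, f (mode p σ) := by
  rw [← Fintype.sum_prod_type']
  let e : Site M × Fin 2 ≃ Mode M :=
    { toFun := fun x => mode x.1 x.2
      invFun := fun m => (ofLex (ofLex m).1, (ofLex m).2)
      left_inv := fun _ => rfl
      right_inv := fun _ => rfl }
  exact (Fintype.sum_equiv e _ _ fun _ => rfl).symm

theorem k_dotProduct_site {Ω : ℝ} (hΩ : 0 < Ω) (ν p : Site M) :
    k Ω ν ⬝ᵥ site Ω p = ∑ i, 2 * Real.pi * (freq ν i : ℝ) * ((p i : ℕ) : ℝ) / M := by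
  have h : (Ω / (M : ℝ) ^ 3) ^ (1 / 3 : ℝ) = Ω ^ (1 / 3 : ℝ) / M := by
    rw [Real.div_rpow hΩ.le (by positivity), ← Real.rpow_natCast, ← Real.rpow_mul (by positivity)]
    norm_num
  have h0 : Ω ^ (1 / 3 : ℝ) ≠ 0 := (Real.rpow_pos_of_pos hΩ _).ne'
  rw [dotProduct]
  refine Finset.sum_congr rfl fun i _ => ?_
  rw [k, site, h]
  field_simp

/-- The amplitude of the plane wave `ν` on the lattice site `p`. -/
noncomputable def waveCoeff (Ω : ℝ) (ν p : Site M) : ℂ :=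
  ((1 / Real.sqrt ((M : ℝ) ^ 3) : ℝ) : ℂ) *
    Complex.exp (-(Complex.I * ((k Ω ν ⬝ᵥ site Ω p : ℝ) : ℂ)))

theorem planeWaveCreate_eq_sum (Ω : ℝ) (ν : Site M) (σ : Fin 2) :
    planeWaveCreate Ω ν σ = ∑ p, waveCoeff Ω ν p • create (mode p σ) := by
  simp only [planeWaveCreate, Finset.smul_sum, smul_smul, waveCoeff]

/-- The amplitudes of the plane wave spin orbital `i` in the spin orbitals `(p, σ)`. -/
noncomputable def modeCoeff (Ω : ℝ) (i m : Mode M) : ℂ :=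
  if (ofLex m).2 = (ofLex i).2 then waveCoeff Ω (ofLex (ofLex i).1) (ofLex (ofLex m).1) else 0

theorem star_waveCoeff (Ω : ℝ) (ν p : Site M) : (starRingEnd ℂ) (waveCoeff Ω ν p) =
    ((1 / Real.sqrt ((M : ℝ) ^ 3) : ℝ) : ℂ) *
      Complex.exp (Complex.I * ((k Ω ν ⬝ᵥ site Ω p : ℝ) : ℂ)) := by
  rw [waveCoeff, map_mul, Complex.conj_ofReal, ← Complex.exp_conj]
  simp

theorem inv_sqrt_mul_inv_sqrt (M : ℕ) :
    ((1 / Real.sqrt ((M : ℝ) ^ 3) : ℝ) : ℂ) * ((1 / Real.sqrt ((M : ℝ) ^ 3) : ℝ) : ℂ) =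
      ((1 / (M : ℝ) ^ 3 : ℝ) : ℂ) := by
  rw [← Complex.ofReal_mul, div_mul_div_comm, Real.mul_self_sqrt (by positivity), one_mul]

/-- Orthogonality of distinct characters of `ℤ/M`, as a vanishing geometric sum. -/
theorem sum_exp_eq_zero {a b : Fin M} (h : a ≠ b) :
    ∑ x : Fin M, Complex.exp
      (2 * Real.pi * Complex.I * (((a : ℕ) : ℂ) - ((b : ℕ) : ℂ)) / M * ((x : ℕ) : ℂ)) = 0 := by
  have hM : (M : ℂ) ≠ 0 := by
    have : 0 < M := a.pos
    exact_mod_cast this.ne'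
  set w := Complex.exp (2 * Real.pi * Complex.I * (((a : ℕ) : ℂ) - ((b : ℕ) : ℂ)) / M) with hw
  have hpow : ∀ x : ℕ, Complex.exp
      (2 * Real.pi * Complex.I * (((a : ℕ) : ℂ) - ((b : ℕ) : ℂ)) / M * (x : ℂ)) = w ^ x := by
    intro x
    rw [hw, ← Complex.exp_nat_mul, mul_comm]
  simp only [hpow]
  rw [Fin.sum_univ_eq_sum_range (fun x => w ^ x) M]
  have h1 : w ^ M = 1 := by
    rw [← hpow, Complex.exp_eq_one_iff]
    refine ⟨((a : ℕ) : ℤ) - ((b : ℕ) : ℤ), ?_⟩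
    push_cast
    field_simp
  have h2 : w ≠ 1 := by
    intro hw1
    obtain ⟨n, hn⟩ := Complex.exp_eq_one_iff.1 hw1
    have hpi : (2 * Real.pi * Complex.I : ℂ) ≠ 0 := Complex.two_pi_I_ne_zero
    have h3 : ((a : ℕ) : ℂ) - ((b : ℕ) : ℂ) = n * M := by
      have : (2 * Real.pi * Complex.I : ℂ) * (((a : ℕ) : ℂ) - ((b : ℕ) : ℂ)) =
          (2 * Real.pi * Complex.I : ℂ) * (n * M) := by
        rw [div_eq_iff hM] at hn
        rw [hn]; ring
      exact mul_left_cancel₀ hpi this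
    have h4 : ((a : ℕ) : ℤ) - ((b : ℕ) : ℤ) = n * M := by exact_mod_cast h3
    have ha := a.isLt
    have hb := b.isLt
    have h5 : |n * (M : ℤ)| < M := by rw [← h4, abs_lt]; omega
    rw [abs_mul, Nat.abs_cast] at h5
    have h6 : |n| < 1 := by
      by_contra hc
      have := mul_le_mul_of_nonneg_right (not_lt.1 hc) (Int.natCast_nonneg M)
      omega
    rw [Int.abs_lt_one_iff.1 h6, zero_mul] at h4
    exact h (Fin.ext (by omega))
  have := mul_neg_geom_sum w M
  rw [h1, sub_self] at this
  exact (mul_eq_zero.1 this).resolve_left (sub_ne_zero.2 h2.symm)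

/-- Orthonormality of the plane waves. -/
theorem sum_star_waveCoeff_mul_waveCoeff {Ω : ℝ} (hM : 0 < M) (hΩ : 0 < Ω) (ν μ : Site M) :
    ∑ p, (starRingEnd ℂ) (waveCoeff Ω ν p) * waveCoeff Ω μ p = if ν = μ then 1 else 0 := by
  have hterm : ∀ p : Site M, (starRingEnd ℂ) (waveCoeff Ω ν p) * waveCoeff Ω μ p =
      ((1 / (M : ℝ) ^ 3 : ℝ) : ℂ) * ∏ i, Complex.exp
        (2 * Real.pi * Complex.I * (((ν i : ℕ) : ℂ) - ((μ i : ℕ) : ℂ)) / M * ((p i : ℕ) : ℂ)) := by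
    intro p
    rw [star_waveCoeff, waveCoeff, mul_mul_mul_comm, inv_sqrt_mul_inv_sqrt, ← Complex.exp_add,
      ← Complex.exp_sum, k_dotProduct_site hΩ, k_dotProduct_site hΩ]
    congr 2
    push_cast
    rw [Finset.mul_sum, Finset.mul_sum, ← sub_eq_add_neg, ← Finset.sum_sub_distrib]
    refine Finset.sum_congr rfl fun i _ => ?_
    rw [freq, freq]
    push_cast
    ring
  simp only [hterm]
  rw [← Finset.mul_sum, ← Fintype.piFinset_univ,
    ← Finset.prod_univ_sum (fun _ : Fin 3 => (Finset.univ : Finset (Fin M))) (fun i x => Complex.exp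
        (2 * Real.pi * Complex.I * (((ν i : ℕ) : ℂ) - ((μ i : ℕ) : ℂ)) / M * ((x : ℕ) : ℂ)))]
  split_ifs with h
  · subst h
    have : (M : ℂ) ≠ 0 := by exact_mod_cast hM.ne'
    simp [this]
  · obtain ⟨i, hi⟩ := Function.ne_iff.1 h
    rw [Finset.prod_eq_zero (Finset.mem_univ i) (sum_exp_eq_zero hi), mul_zero]

theorem planeWaveCreate_eq_createVec (Ω : ℝ) (i : Mode M) :
    planeWaveCreate Ω (ofLex (ofLex i).1) (ofLex i).2 = createVec (modeCoeff Ω i) := by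
  rw [createVec, sum_mode, planeWaveCreate_eq_sum]
  refine Finset.sum_congr rfl fun p _ => ?_
  rw [Finset.sum_eq_single (ofLex i).2]
  · rw [show modeCoeff Ω i (mode p (ofLex i).2) = waveCoeff Ω (ofLex (ofLex i).1) p from if_pos rfl]
  · intro σ _ hσ
    rw [show modeCoeff Ω i (mode p σ) = 0 from if_neg hσ]
    exact zero_smul ℂ (create (mode p σ))
  · intro h
    exact absurd (Finset.mem_univ _) h

theorem sum_star_modeCoeff_mul_modeCoeff {Ω : ℝ} (hM : 0 < M) (hΩ : 0 < Ω) (i j : Mode M) :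
    ∑ m, (starRingEnd ℂ) (modeCoeff Ω i m) * modeCoeff Ω j m =
      if (ofLex i).2 = (ofLex j).2 then
        if ofLex (ofLex i).1 = ofLex (ofLex j).1 then 1 else 0 else 0 := by
  have h : ∀ p : Site M, ∑ σ : Fin 2, (starRingEnd ℂ) (modeCoeff Ω i (mode p σ)) *
      modeCoeff Ω j (mode p σ) =
      if (ofLex i).2 = (ofLex j).2 then (starRingEnd ℂ) (waveCoeff Ω (ofLex (ofLex i).1) p) *
        waveCoeff Ω (ofLex (ofLex j).1) p else 0 := by
    intro p
    have hc : ∀ (m : Mode M) (σ : Fin 2), modeCoeff Ω m (mode p σ) =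
      if σ = (ofLex m).2 then waveCoeff Ω (ofLex (ofLex m).1) p else 0 := fun m σ => rfl
    simp only [hc]
    rw [Finset.sum_eq_single (ofLex i).2]
    · rw [if_pos rfl, mul_ite, mul_zero]
    · intro σ _ hσ
      rw [if_neg hσ, map_zero, zero_mul]
    · intro h
      exact absurd (Finset.mem_univ _) h
  rw [sum_mode, Finset.sum_congr rfl fun p _ => h p]
  split_ifs with h1 h2
  · rw [sum_star_waveCoeff_mul_waveCoeff hM hΩ, if_pos h2]
  · rw [sum_star_waveCoeff_mul_waveCoeff hM hΩ, if_neg h2]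
  · exact Finset.sum_const_zero

theorem modeCoeff_normalized {Ω : ℝ} (hM : 0 < M) (hΩ : 0 < Ω) (i : Mode M) :
    ∑ m, (starRingEnd ℂ) (modeCoeff Ω i m) * modeCoeff Ω i m = 1 := by
  rw [sum_star_modeCoeff_mul_modeCoeff hM hΩ, if_pos rfl, if_pos rfl]

theorem modeCoeff_orthogonal {Ω : ℝ} (hM : 0 < M) (hΩ : 0 < Ω) (i j : Mode M) (hij : i ≠ j) :
    ∑ m, (starRingEnd ℂ) (modeCoeff Ω i m) * modeCoeff Ω j m = 0 := by
  rw [sum_star_modeCoeff_mul_modeCoeff hM hΩ]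
  split_ifs with h1 h2
  · exact absurd (ofLex.injective (Prod.ext (ofLex.injective h2) h1)) hij
  · rfl
  · rfl

theorem star_FFFT (Ω : ℝ) : star (FFFT M Ω) = slaterMap fun i => createVec (modeCoeff Ω i) := by
  rw [FFFT, ← ContinuousLinearMap.star_eq_adjoint, star_star]
  congr 1
  funext i
  exact planeWaveCreate_eq_createVec Ω i

theorem FFFT_mul_star_FFFT {Ω : ℝ} (hM : 0 < M) (hΩ : 0 < Ω) : FFFT M Ω * star (FFFT M Ω) = 1 := by
  have := star_slaterMap_createVec_mul_self (modeCoeff_normalized hM hΩ)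
    (modeCoeff_orthogonal hM hΩ)
  rwa [← star_FFFT, star_star] at this

theorem star_FFFT_mul_FFFT {Ω : ℝ} (hM : 0 < M) (hΩ : 0 < Ω) : star (FFFT M Ω) * FFFT M Ω = 1 := by
  have := slaterMap_createVec_mul_star_self (modeCoeff_normalized hM hΩ)
    (modeCoeff_orthogonal hM hΩ)
  rwa [← star_FFFT, star_star] at this

theorem commute_sum_number_star_FFFT (Ω : ℝ) :
    Commute (∑ i : Mode M, number i) (star (FFFT M Ω)) := by
  rw [star_FFFT]
  exact commute_sum_number_slaterMap_createVec _

theorem star_FFFT_mul_number {Ω : ℝ} (hM : 0 < M) (hΩ : 0 < Ω) (ν : Site M) (σ : Fin 2) :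
    star (FFFT M Ω) * number (mode ν σ) =
      planeWaveCreate Ω ν σ * star (planeWaveCreate Ω ν σ) * star (FFFT M Ω) := by
  rw [star_FFFT, show planeWaveCreate Ω ν σ = createVec (modeCoeff Ω (mode ν σ)) from
    planeWaveCreate_eq_createVec Ω (mode ν σ)]
  exact slaterMap_createVec_mul_number (modeCoeff_normalized hM hΩ) (modeCoeff_orthogonal hM hΩ) _

/-! ### The kinetic operator in the plane wave basis -/

/-- The label of the frequency `-ν` modulo `M`. For even `M` the component `-M/2` has no negative in
the range of frequencies and is mapped to itself. -/
def negLabel (ν : Site M) : Site M := fun i =>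
  ⟨if 2 * (M / 2) - (ν i : ℕ) < M then 2 * (M / 2) - (ν i : ℕ) else 0, by
    have := (ν i).isLt
    split_ifs <;> omega⟩

theorem negLabel_involutive : Function.Involutive (negLabel (M := M)) := by
  intro ν
  funext i
  have := (ν i).isLt
  simp only [negLabel, Fin.ext_iff]
  split_ifs <;> omega

theorem freq_negLabel (ν : Site M) (i : Fin 3) :
    freq (negLabel ν) i = -freq ν i ∨ (freq (negLabel ν) i = -freq ν i - M ∧
      freq (negLabel ν) i = freq ν i) := by
  have := (ν i).isLt
  simp only [negLabel, freq]
  split_ifs <;> omega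

theorem kSq_eq (Ω : ℝ) (ν : Site M) :
    kSq Ω ν = (2 * Real.pi / Ω ^ (1 / 3 : ℝ)) ^ 2 * ∑ i, (freq ν i : ℝ) ^ 2 := by
  rw [kSq, dotProduct, Finset.mul_sum]
  refine Finset.sum_congr rfl fun i _ => ?_
  rw [k]; ring

theorem kSq_negLabel (Ω : ℝ) (ν : Site M) : kSq Ω (negLabel ν) = kSq Ω ν := by
  rw [kSq_eq, kSq_eq]
  congr 1
  refine Finset.sum_congr rfl fun i _ => ?_
  rcases freq_negLabel ν i with h | ⟨-, h⟩ <;> rw [h]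
  push_cast; ring

theorem k_dotProduct_site_sub {Ω : ℝ} (hΩ : 0 < Ω) (ν p q : Site M) :
    k Ω ν ⬝ᵥ (site Ω q - site Ω p) =
      ∑ i, 2 * Real.pi * (freq ν i : ℝ) * (((q i : ℕ) : ℝ) - ((p i : ℕ) : ℝ)) / M := by
  rw [dotProduct_sub, k_dotProduct_site hΩ, k_dotProduct_site hΩ, ← Finset.sum_sub_distrib]
  refine Finset.sum_congr rfl fun i _ => ?_
  ring

theorem sin_negLabel {Ω : ℝ} (hM : 0 < M) (hΩ : 0 < Ω) (ν p q : Site M) :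
    Real.sin (k Ω (negLabel ν) ⬝ᵥ (site Ω q - site Ω p)) =
      -Real.sin (k Ω ν ⬝ᵥ (site Ω q - site Ω p)) := by
  have hM' : (M : ℝ) ≠ 0 := by exact_mod_cast hM.ne'
  have key : ∃ n : ℤ, k Ω (negLabel ν) ⬝ᵥ (site Ω q - site Ω p) =
      -(k Ω ν ⬝ᵥ (site Ω q - site Ω p)) + n * (2 * Real.pi) := by
    have hi : ∀ i : Fin 3, ∃ n : ℤ, 2 * Real.pi * (freq (negLabel ν) i : ℝ) *
        (((q i : ℕ) : ℝ) - ((p i : ℕ) : ℝ)) / M =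
        -(2 * Real.pi * (freq ν i : ℝ) * (((q i : ℕ) : ℝ) - ((p i : ℕ) : ℝ)) / M) +
          n * (2 * Real.pi) := by
      intro i
      rcases freq_negLabel ν i with h | ⟨h, -⟩
      · exact ⟨0, by rw [h]; push_cast; ring⟩
      · refine ⟨-(((q i : ℕ) : ℤ) - ((p i : ℕ) : ℤ)), ?_⟩
        rw [h]; push_cast; field_simp; ring
    choose n hn using hi
    refine ⟨∑ i, n i, ?_⟩
    rw [k_dotProduct_site_sub hΩ, k_dotProduct_site_sub hΩ, Finset.sum_congr rfl fun i _ => hn i,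
      Finset.sum_add_distrib, Finset.sum_neg_distrib, ← Finset.sum_mul]
    push_cast; rfl
  obtain ⟨n, hn⟩ := key
  rw [hn, Real.sin_add_int_mul_two_pi, Real.sin_neg]

theorem sum_kSq_mul_sin {Ω : ℝ} (hM : 0 < M) (hΩ : 0 < Ω) (p q : Site M) :
    ∑ ν : Site M, kSq Ω ν * Real.sin (k Ω ν ⬝ᵥ (site Ω q - site Ω p)) = 0 := by
  have h := Equiv.sum_comp (negLabel_involutive (M := M)).toPerm
    fun ν => kSq Ω ν * Real.sin (k Ω ν ⬝ᵥ (site Ω q - site Ω p))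
  simp only [Function.Involutive.coe_toPerm, kSq_negLabel, sin_negLabel hM hΩ, mul_neg,
    Finset.sum_neg_distrib] at h
  linarith

theorem sum_kSq_mul_waveCoeff {Ω : ℝ} (hM : 0 < M) (hΩ : 0 < Ω) (p q : Site M) :
    ∑ ν : Site M, ((kSq Ω ν / 2 : ℝ) : ℂ) * (waveCoeff Ω ν p * (starRingEnd ℂ) (waveCoeff Ω ν q)) =
      ((1 / (2 * (M : ℝ) ^ 3) : ℝ) : ℂ) *
        ∑ ν : Site M, ((kSq Ω ν * Real.cos (k Ω ν ⬝ᵥ (site Ω q - site Ω p)) : ℝ) : ℂ) := by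
  have hterm : ∀ ν : Site M,
      ((kSq Ω ν / 2 : ℝ) : ℂ) * (waveCoeff Ω ν p * (starRingEnd ℂ) (waveCoeff Ω ν q)) =
      ((1 / (2 * (M : ℝ) ^ 3) : ℝ) : ℂ) *
        (((kSq Ω ν * Real.cos (k Ω ν ⬝ᵥ (site Ω q - site Ω p)) : ℝ) : ℂ) +
        ((kSq Ω ν * Real.sin (k Ω ν ⬝ᵥ (site Ω q - site Ω p)) : ℝ) : ℂ) * Complex.I) := by
    intro ν
    have e : -(Complex.I * ((k Ω ν ⬝ᵥ site Ω p : ℝ) : ℂ)) +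
        Complex.I * ((k Ω ν ⬝ᵥ site Ω q : ℝ) : ℂ) =
        ((k Ω ν ⬝ᵥ (site Ω q - site Ω p) : ℝ) : ℂ) * Complex.I := by
      rw [dotProduct_sub]; push_cast; ring
    rw [star_waveCoeff, waveCoeff, mul_mul_mul_comm, inv_sqrt_mul_inv_sqrt, ← Complex.exp_add, e,
      Complex.exp_mul_I]
    push_cast
    ring
  simp only [hterm]
  rw [← Finset.mul_sum, Finset.sum_add_distrib, ← Finset.sum_mul, ← Complex.ofReal_sum,
    ← Complex.ofReal_sum, sum_kSq_mul_sin hM hΩ]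
  simp

/-- Conjugation with the fermionic Fourier transform turns the diagonal kinetic operator into the
kinetic operator in the dual basis. The imaginary parts of the matrix elements cancel because `k_ν²`
is even in `ν`. -/
theorem star_FFFT_mul_kineticDiag {Ω : ℝ} (hM : 0 < M) (hΩ : 0 < Ω) :
    star (FFFT M Ω) * kineticDiag M Ω = kinetic M Ω * star (FFFT M Ω) := by
  refine mul_sum_smul_of_intertwine (c := fun p σ => create (mode p σ)) (w := waveCoeff Ω)
    (fun ν σ => ?_) (sum_kSq_mul_waveCoeff hM hΩ)
  rw [star_FFFT_mul_number hM hΩ, planeWaveCreate_eq_sum]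

/-! ### Real diagonal operators -/

section RealDiag

variable {ι : Type*} [LinearOrder ι]

/-- The occupation number, `0` or `1`, of the mode `i` in `|S⟩`. -/
noncomputable def occNum (i : ι) (S : Finset ι) : ℝ := if i ∈ S then 1 else 0

theorem occNum_nonneg (i : ι) (S : Finset ι) : 0 ≤ occNum i S := by
  rw [occNum]; split_ifs <;> norm_num

variable [Fintype ι]

/-- The observable with value `f S` on the occupation number state `|S⟩`. -/
noncomputable def realDiag (f : Finset ι → ℝ) : FockOp ι := diagOp fun S => (f S : ℂ)

theorem realDiag_add (f g : Finset ι → ℝ) :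
    realDiag f + realDiag g = realDiag fun S => f S + g S := by
  rw [realDiag, realDiag, ← diagOp_add, realDiag]
  congr 1
  funext S
  simp

theorem realDiag_smul (c : ℝ) (f : Finset ι → ℝ) :
    (c : ℂ) • realDiag f = realDiag fun S => c * f S := by
  rw [realDiag, ← diagOp_smul, realDiag]
  congr 1
  funext S
  simp

theorem realDiag_sum {κ : Type*} (s : Finset κ) (f : κ → Finset ι → ℝ) :
    ∑ x ∈ s, realDiag (f x) = realDiag fun S => ∑ x ∈ s, f x S := by
  simp only [realDiag]
  rw [← diagOp_sum]
  congr 1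
  funext S
  simp

theorem realDiag_mul (f g : Finset ι → ℝ) :
    realDiag f * realDiag g = realDiag fun S => f S * g S := by
  rw [realDiag, realDiag, diagOp_mul, realDiag]
  congr 1
  funext S
  simp

theorem realDiag_zero : realDiag (fun _ : Finset ι => 0) = 0 := by
  rw [realDiag, ← diagOp_zero, Complex.ofReal_zero]
  rfl

theorem star_realDiag (f : Finset ι → ℝ) : star (realDiag f) = realDiag f := by
  rw [realDiag, star_diagOp]
  congr 1
  funext S
  simp

theorem norm_realDiag_mul_sectorProj_le {f : Finset ι → ℝ} {η : ℕ} {C : ℝ} (hC : 0 ≤ C)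
    (hf : ∀ S : Finset ι, S.card = η → |f S| ≤ C) : ‖realDiag f * sectorProj ι η‖ ≤ C :=
  norm_diagOp_mul_sectorProj_le hC fun S hS => by simpa using hf S hS

theorem commute_sectorProj_realDiag (η : ℕ) (f : Finset ι → ℝ) :
    Commute (sectorProj ι η) (realDiag f) := commute_sectorProj_diagOp η _

theorem number_eq_realDiag (i : ι) : number i = realDiag (occNum i) := by
  rw [number_eq_diagOp, realDiag]
  congr 1
  funext S
  simp only [occNum]
  split_ifs <;> simp

theorem sum_occNum (S : Finset ι) : ∑ i, occNum i S = S.card := by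
  simp [occNum]

end RealDiag

/-! ### Bounds on the Coulomb and kinetic energies in a particle number sector -/

theorem sum_occNum_mode (S : Finset (Mode M)) :
    ∑ p : Site M, ∑ σ : Fin 2, occNum (mode p σ) S = S.card := by
  rw [← sum_mode fun m => occNum m S, sum_occNum]

theorem abs_sum_mul_occNum_le {c : Site M → Fin 2 → ℝ} {C : ℝ} (hc : ∀ p σ, |c p σ| ≤ C)
    (S : Finset (Mode M)) : |∑ p, ∑ σ, c p σ * occNum (mode p σ) S| ≤ C * S.card := by
  rw [← sum_occNum_mode, Finset.mul_sum]
  refine (Finset.abs_sum_le_sum_abs _ _).trans (Finset.sum_le_sum fun p _ => ?_)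
  rw [Finset.mul_sum]
  refine (Finset.abs_sum_le_sum_abs _ _).trans (Finset.sum_le_sum fun σ _ => ?_)
  rw [abs_mul, abs_of_nonneg (occNum_nonneg _ _)]
  exact mul_le_mul_of_nonneg_right (hc p σ) (occNum_nonneg _ _)

theorem two_mul_abs_freq_le (ν : Site M) (i : Fin 3) : 2 * |freq ν i| ≤ M := by
  have := (ν i).isLt
  rw [freq]
  have : |((ν i : ℕ) : ℤ) - ((M / 2 : ℕ) : ℤ)| = ((ν i : ℕ) : ℤ) - ((M / 2 : ℕ) : ℤ) ∨
    |((ν i : ℕ) : ℤ) - ((M / 2 : ℕ) : ℤ)| = -(((ν i : ℕ) : ℤ) - ((M / 2 : ℕ) : ℤ)) := abs_choice _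
  omega

theorem card_abs_sub_le (c : ℤ) (n : ℕ) :
    (Finset.univ.filter fun y : Fin M => |((y : ℕ) : ℤ) - c| ≤ n).card ≤ 2 * n + 1 := by
  have h : (Finset.univ.filter fun y : Fin M => |((y : ℕ) : ℤ) - c| ≤ n).card ≤
      (Finset.Icc (c - n) (c + n)).card := by
    refine Finset.card_le_card_of_injOn (fun y => ((y : ℕ) : ℤ)) (fun y hy => ?_)
      fun x _ y _ h => ?_
    · have := (Finset.mem_filter.1 (Finset.mem_coe.1 hy)).2
      rw [abs_le] at this
      simp only [Finset.coe_Icc, Set.mem_Icc]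
      omega
    · exact Fin.ext (Int.ofNat.inj h)
  refine h.trans ?_
  rw [Int.card_Icc]
  omega

/-- The labels in the cube of half-width `n` with a given `i`-th component, a slice of the cube. -/
theorem card_face_le (i : Fin 3) (x : Fin M) (n : ℕ) :
    (Finset.univ.filter fun ν : Site M => ν i = x ∧ ∀ j, |freq ν j| ≤ n).card ≤
      (2 * n + 1) ^ 2 := by
  let s : Fin 3 → Finset (Fin M) := fun j => if j = i then {x} else
    Finset.univ.filter fun y : Fin M => |((y : ℕ) : ℤ) - ((M / 2 : ℕ) : ℤ)| ≤ n
  have h : (Finset.univ.filter fun ν : Site M => ν i = x ∧ ∀ j, |freq ν j| ≤ n) ⊆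
      Fintype.piFinset s := by
    intro ν hν
    obtain ⟨h1, h2⟩ := (Finset.mem_filter.1 hν).2
    refine Fintype.mem_piFinset.2 fun j => ?_
    by_cases hj : j = i
    · simp [s, hj, h1]
    · simpa [s, hj, freq] using h2 j
  refine (Finset.card_le_card h).trans ?_
  have hs : ∀ j, j ≠ i → (s j).card ≤ 2 * n + 1 := fun j hj => by
    simp only [s, if_neg hj]
    exact card_abs_sub_le _ n
  have hi : (s i).card = 1 := by simp [s]
  rw [Fintype.card_piFinset, ← Finset.mul_prod_erase _ _ (Finset.mem_univ i), hi, one_mul]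
  refine (Finset.prod_le_pow_card _ _ _ fun j hj => hs j (Finset.ne_of_mem_erase hj)).trans ?_
  simp

/-- The lattice sum of the Coulomb kernel grows linearly in the cutoff: the labels whose largest
component is `m` in absolute value number `O(m²)`, and each contributes at most `1 / m²`. -/
theorem sum_inv_sum_freq_sq_le (M : ℕ) :
    ∑ ν ∈ nonzeroFreq M, 1 / ∑ i, (freq ν i : ℝ) ^ 2 ≤ 27 * M := by
  let g : Fin 3 → Site M → ℝ := fun i ν =>
    if ∀ j, |freq ν j| ≤ |freq ν i| then 1 / (freq ν i : ℝ) ^ 2 else 0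
  have hg : ∀ i ν, 0 ≤ g i ν := fun i ν => by
    simp only [g]; split_ifs <;> positivity
  have h1 : ∀ ν ∈ nonzeroFreq M, 1 / ∑ i, (freq ν i : ℝ) ^ 2 ≤ ∑ i, g i ν := by
    intro ν hν
    obtain ⟨i, -, hi⟩ := Finset.exists_max_image Finset.univ (fun i => |freq ν i|)
      Finset.univ_nonempty
    have hi' : ∀ j, |freq ν j| ≤ |freq ν i| := fun j => hi j (Finset.mem_univ j)
    have h0 : freq ν i ≠ 0 := by
      intro h
      refine (Finset.mem_filter.1 hν).2 (funext fun j => ?_)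
      have := hi' j
      rw [h, abs_zero] at this
      exact abs_nonpos_iff.1 this
    have h0' : (0 : ℝ) < (freq ν i : ℝ) ^ 2 := by
      have : (freq ν i : ℝ) ≠ 0 := by exact_mod_cast h0
      positivity
    refine le_trans ?_ (Finset.single_le_sum (fun j _ => hg j ν) (Finset.mem_univ i))
    simp only [g, if_pos hi']
    exact one_div_le_one_div_of_le h0'
      (Finset.single_le_sum (f := fun i => (freq ν i : ℝ) ^ 2) (fun j _ => sq_nonneg _)
        (Finset.mem_univ i))
  have h2 : ∀ i, ∑ ν : Site M, g i ν ≤ 9 * M := by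
    intro i
    rw [← Finset.sum_fiberwise Finset.univ (fun ν : Site M => ν i) (g i)]
    have h3 : ∀ x : Fin M, ∑ ν ∈ Finset.univ.filter (fun ν : Site M => ν i = x), g i ν ≤ 9 := by
      intro x
      set n : ℕ := (((x : ℕ) : ℤ) - ((M / 2 : ℕ) : ℤ)).natAbs with hn
      have hf : ∀ ν : Site M, ν i = x → |freq ν i| = n := fun ν hν => by
        rw [hn, freq, hν, Int.natCast_natAbs]
      have h4 : ∑ ν ∈ Finset.univ.filter (fun ν : Site M => ν i = x), g i ν =
          ∑ ν ∈ Finset.univ.filter (fun ν : Site M => ν i = x ∧ ∀ j, |freq ν j| ≤ n),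
            1 / (n : ℝ) ^ 2 := by
        rw [← Finset.filter_filter, Finset.sum_filter (fun ν : Site M => ∀ j, |freq ν j| ≤ n)]
        refine Finset.sum_congr rfl fun ν hν => ?_
        have e := hf ν (Finset.mem_filter.1 hν).2
        have e2 : (freq ν i : ℝ) ^ 2 = (n : ℝ) ^ 2 := by
          rw [← sq_abs]
          congr 1
          exact_mod_cast e
        simp only [g, e, e2]
      rw [h4, Finset.sum_const, nsmul_eq_mul]
      rcases Nat.eq_zero_or_pos n with h0 | hpos
      · simp [h0]
      · have hn1 : (1 : ℝ) ≤ n := by exact_mod_cast hpos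
        have hc : ((Finset.univ.filter fun ν : Site M =>
            ν i = x ∧ ∀ j, |freq ν j| ≤ n).card : ℝ) ≤ (2 * n + 1) ^ 2 := by
          exact_mod_cast card_face_le i x n
        rw [mul_one_div, div_le_iff₀ (by positivity)]
        refine hc.trans ?_
        nlinarith
    refine (Finset.sum_le_sum fun x _ => h3 x).trans ?_
    simp [mul_comm]
  calc ∑ ν ∈ nonzeroFreq M, 1 / ∑ i, (freq ν i : ℝ) ^ 2
      ≤ ∑ ν ∈ nonzeroFreq M, ∑ i, g i ν := Finset.sum_le_sum h1
    _ ≤ ∑ ν : Site M, ∑ i, g i ν :=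
        Finset.sum_le_sum_of_subset_of_nonneg (Finset.subset_univ _) fun ν _ _ =>
          Finset.sum_nonneg fun i _ => hg i ν
    _ = ∑ i, ∑ ν : Site M, g i ν := Finset.sum_comm
    _ ≤ ∑ _i : Fin 3, 9 * (M : ℝ) := Finset.sum_le_sum fun i _ => h2 i
    _ = 27 * M := by simp; ring

theorem kSq_nonneg (Ω : ℝ) (ν : Site M) : 0 ≤ kSq Ω ν := by
  rw [kSq_eq]; positivity

theorem sum_inv_kSq_le {Ω : ℝ} (hΩ : 0 < Ω) :
    ∑ ν ∈ nonzeroFreq M, 1 / kSq Ω ν ≤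
      27 * M * (Ω ^ (1 / 3 : ℝ)) ^ 2 / (4 * Real.pi ^ 2) := by
  have hL : 0 < Ω ^ (1 / 3 : ℝ) := Real.rpow_pos_of_pos hΩ _
  have h : ∀ ν : Site M, 1 / kSq Ω ν =
      (Ω ^ (1 / 3 : ℝ)) ^ 2 / (4 * Real.pi ^ 2) * (1 / ∑ i, (freq ν i : ℝ) ^ 2) := by
    intro ν
    rw [kSq_eq, one_div, mul_inv, one_div (∑ i, _)]
    congr 1
    have := Real.pi_ne_zero
    field_simp
    norm_num
  simp only [h]
  rw [← Finset.mul_sum]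
  refine (mul_le_mul_of_nonneg_left (sum_inv_sum_freq_sq_le M) (by positivity)).trans_eq ?_
  ring

theorem abs_sum_cos_div_kSq_le {Ω : ℝ} (hΩ : 0 < Ω) (θ : Site M → ℝ) :
    |∑ ν ∈ nonzeroFreq M, Real.cos (θ ν) / kSq Ω ν| ≤
      27 * M * (Ω ^ (1 / 3 : ℝ)) ^ 2 / (4 * Real.pi ^ 2) := by
  refine le_trans ((Finset.abs_sum_le_sum_abs _ _).trans (Finset.sum_le_sum fun ν _ => ?_))
    (sum_inv_kSq_le hΩ)
  rw [abs_div, abs_of_nonneg (kSq_nonneg Ω ν)]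
  exact div_le_div_of_nonneg_right (Real.abs_cos_le_one _) (kSq_nonneg Ω ν)

theorem cbrt_pow_three {Ω : ℝ} (hΩ : 0 < Ω) : (Ω ^ (1 / 3 : ℝ)) ^ 3 = Ω := by
  rw [← Real.rpow_natCast, ← Real.rpow_mul hΩ.le]
  norm_num

/-- The external potential is diagonal, with energies `O(η ∑ |ζ_j| M / Ω^{1/3})`. -/
theorem external_eq_realDiag {Ω : ℝ} (hΩ : 0 < Ω) {J : ℕ} (ζ : Fin J → ℝ) (R : Fin J → Fin 3 → ℝ) :
    ∃ f : Finset (Mode M) → ℝ, external M Ω ζ R = realDiag f ∧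
      ∀ S, |f S| ≤ 9 * (∑ j, |ζ j|) * M / Ω ^ (1 / 3 : ℝ) * S.card := by
  have hL : 0 < Ω ^ (1 / 3 : ℝ) := Real.rpow_pos_of_pos hΩ _
  have hL3 := cbrt_pow_three hΩ
  refine ⟨fun S => -(4 * Real.pi / Ω) * ∑ p : Site M, ∑ σ : Fin 2, ∑ j : Fin J, ∑ ν ∈ nonzeroFreq M,
    (ζ j * Real.cos (k Ω ν ⬝ᵥ (R j - site Ω p)) / kSq Ω ν) * occNum (mode p σ) S, ?_, fun S => ?_⟩
  · simp only [external, number_eq_realDiag, realDiag_smul, realDiag_sum]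
  · simp only [← Finset.sum_mul]
    have hc : ∀ (p : Site M) (_ : Fin 2), |∑ j : Fin J, ∑ ν ∈ nonzeroFreq M,
        ζ j * Real.cos (k Ω ν ⬝ᵥ (R j - site Ω p)) / kSq Ω ν| ≤
        (∑ j, |ζ j|) * (27 * M * (Ω ^ (1 / 3 : ℝ)) ^ 2 / (4 * Real.pi ^ 2)) := by
      intro p _
      rw [Finset.sum_mul]
      refine (Finset.abs_sum_le_sum_abs _ _).trans (Finset.sum_le_sum fun j _ => ?_)
      simp only [mul_div_assoc]
      rw [← Finset.mul_sum, abs_mul]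
      have := abs_sum_cos_div_kSq_le (M := M) hΩ fun ν => k Ω ν ⬝ᵥ (R j - site Ω p)
      rw [mul_div_assoc] at this
      exact mul_le_mul_of_nonneg_left this (abs_nonneg _)
    rw [abs_mul, abs_neg, abs_of_pos (by positivity)]
    refine (mul_le_mul_of_nonneg_left (abs_sum_mul_occNum_le hc S) (by positivity)).trans ?_
    have hZ : 0 ≤ ∑ j, |ζ j| := Finset.sum_nonneg fun j _ => abs_nonneg _
    generalize ∑ j, |ζ j| = Z at hZ
    have e : 4 * Real.pi / Ω * (Z * (27 * M * (Ω ^ (1 / 3 : ℝ)) ^ 2 / (4 * Real.pi ^ 2)) * S.card) =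
        27 / Real.pi * (Z * M / Ω ^ (1 / 3 : ℝ) * S.card) := by
      have := Real.pi_ne_zero
      field_simp
      rw [hL3]
      ring
    have h27 : 27 / Real.pi ≤ 9 := by
      rw [div_le_iff₀ Real.pi_pos]
      linarith [Real.pi_gt_three]
    rw [e]
    refine (mul_le_mul_of_nonneg_right h27 (by positivity)).trans_eq ?_
    ring

/-- The electron repulsion is diagonal, with energies `O(η² M / Ω^{1/3})`. -/
theorem repulsion_eq_realDiag {Ω : ℝ} (hΩ : 0 < Ω) :
    ∃ f : Finset (Mode M) → ℝ, repulsion M Ω = realDiag f ∧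
      ∀ S, |f S| ≤ 9 * M / Ω ^ (1 / 3 : ℝ) * (S.card : ℝ) ^ 2 := by
  have hL : 0 < Ω ^ (1 / 3 : ℝ) := Real.rpow_pos_of_pos hΩ _
  have hL3 := cbrt_pow_three hΩ
  let v : Site M → Fin 2 → Site M → Fin 2 → ℝ := fun p σ q σ' => if (p, σ) = (q, σ') then 0 else
    ∑ ν ∈ nonzeroFreq M, Real.cos (k Ω ν ⬝ᵥ (site Ω p - site Ω q)) / kSq Ω ν
  have hv : ∀ p σ q σ', |v p σ q σ'| ≤ 27 * M * (Ω ^ (1 / 3 : ℝ)) ^ 2 / (4 * Real.pi ^ 2) := by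
    intro p σ q σ'
    simp only [v]
    split_ifs
    · rw [abs_zero]; positivity
    · exact abs_sum_cos_div_kSq_le hΩ _
  refine ⟨fun S => 2 * Real.pi / Ω * ∑ p : Site M, ∑ σ : Fin 2, ∑ q : Site M, ∑ σ' : Fin 2,
    v p σ q σ' * (occNum (mode p σ) S * occNum (mode q σ') S), ?_, fun S => ?_⟩
  · have hterm : ∀ (p : Site M) (σ : Fin 2) (q : Site M) (σ' : Fin 2),
        (if (p, σ) = (q, σ') then (0 : FockOp (Mode M)) else ∑ ν ∈ nonzeroFreq M,
          ((Real.cos (k Ω ν ⬝ᵥ (site Ω p - site Ω q)) / kSq Ω ν : ℝ) : ℂ) •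
            (number (mode p σ) * number (mode q σ'))) =
        realDiag fun S => v p σ q σ' * (occNum (mode p σ) S * occNum (mode q σ') S) := by
      intro p σ q σ'
      simp only [v]
      split_ifs with h
      · simp only [zero_mul, realDiag_zero]
      · simp only [number_eq_realDiag, realDiag_mul, realDiag_smul, realDiag_sum, Finset.sum_mul]
    simp only [repulsion, hterm, realDiag_smul, realDiag_sum]
  · set C := 27 * M * (Ω ^ (1 / 3 : ℝ)) ^ 2 / (4 * Real.pi ^ 2) with hC
    have e1 : ∀ (p : Site M) (σ : Fin 2), ∑ q : Site M, ∑ σ' : Fin 2,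
        v p σ q σ' * (occNum (mode p σ) S * occNum (mode q σ') S) =
        (∑ q : Site M, ∑ σ' : Fin 2, v p σ q σ' * occNum (mode q σ') S) *
          occNum (mode p σ) S := by
      intro p σ
      simp only [Finset.sum_mul]
      exact Finset.sum_congr rfl fun q _ => Finset.sum_congr rfl fun σ' _ => by ring
    simp only [e1]
    have h1 := abs_sum_mul_occNum_le (fun p σ => abs_sum_mul_occNum_le (hv p σ) S) S
    rw [abs_mul, abs_of_pos (by positivity)]
    refine (mul_le_mul_of_nonneg_left h1 (by positivity)).trans ?_
    have e : 2 * Real.pi / Ω * (C * S.card * S.card) =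
        27 / (2 * Real.pi) * (M / Ω ^ (1 / 3 : ℝ) * (S.card : ℝ) ^ 2) := by
      have := Real.pi_ne_zero
      rw [hC]
      field_simp
      rw [hL3]
      ring
    have h27 : 27 / (2 * Real.pi) ≤ 9 := by
      rw [div_le_iff₀ (by positivity)]
      linarith [Real.pi_gt_three]
    rw [e]
    refine (mul_le_mul_of_nonneg_right h27 (by positivity)).trans_eq ?_
    ring

theorem kSq_le {Ω : ℝ} (ν : Site M) :
    kSq Ω ν ≤ 3 * Real.pi ^ 2 * M ^ 2 / (Ω ^ (1 / 3 : ℝ)) ^ 2 := by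
  have h : ∀ i, (freq ν i : ℝ) ^ 2 ≤ (M : ℝ) ^ 2 / 4 := by
    intro i
    have h1 : 2 * |(freq ν i : ℝ)| ≤ M := by exact_mod_cast two_mul_abs_freq_le ν i
    rw [← sq_abs]
    nlinarith [abs_nonneg (freq ν i : ℝ)]
  rw [kSq_eq]
  refine (mul_le_mul_of_nonneg_left (Finset.sum_le_sum fun i _ => h i) (by positivity)).trans_eq ?_
  simp
  ring

/-- The kinetic operator is diagonal in the plane wave basis, with energies `O(η M² / Ω^{2/3})`. -/
theorem kineticDiag_eq_realDiag {Ω : ℝ} :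
    ∃ f : Finset (Mode M) → ℝ, kineticDiag M Ω = realDiag f ∧
      ∀ S, |f S| ≤ 24 * M ^ 2 / (Ω ^ (1 / 3 : ℝ)) ^ 2 * S.card := by
  refine ⟨fun S => ∑ ν : Site M, ∑ σ : Fin 2, kSq Ω ν / 2 * occNum (mode ν σ) S, ?_, fun S => ?_⟩
  · simp only [kineticDiag, number_eq_realDiag, realDiag_smul, realDiag_sum]
  · refine abs_sum_mul_occNum_le (fun ν _ => ?_) S
    rw [abs_of_nonneg (div_nonneg (kSq_nonneg _ _) zero_le_two), div_le_iff₀ two_pos]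
    refine (kSq_le ν).trans ?_
    rw [div_mul_eq_mul_div]
    refine div_le_div_of_nonneg_right ?_ (by positivity)
    have : Real.pi ^ 2 ≤ 16 := by nlinarith [Real.pi_le_four, Real.pi_pos]
    nlinarith [sq_nonneg (M : ℝ)]

/-! ### Splitting errors in a sector -/

section SectorError

open NormedSpace

variable {𝔸 : Type*} [NormedRing 𝔸]

theorem norm_le_one_of_star_mul_self_eq_one [StarRing 𝔸] [CStarRing 𝔸] {u : 𝔸}
    (h : star u * u = 1) : ‖u‖ ≤ 1 := by
  rcases subsingleton_or_nontrivial 𝔸 with hs | hs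
  · rw [Subsingleton.elim u 0, norm_zero]; exact zero_le_one
  · have := CStarRing.norm_star_mul_self (x := u)
    rw [h, CStarRing.norm_one] at this
    nlinarith [norm_nonneg u]

variable [NormedAlgebra ℂ 𝔸]

/-- `e^{-i s X}` -/
noncomputable def propagator (X : 𝔸) (s : ℝ) : 𝔸 := exp ((-(Complex.I * (s : ℂ))) • X)

theorem propagator_eq_exp_smul (X : 𝔸) (s : ℝ) : propagator X s = exp (s • (-(Complex.I • X))) := by
  rw [propagator, ← Complex.coe_smul, ← neg_smul, smul_smul]
  congr 2
  ring

variable [CompleteSpace 𝔸]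

theorem semiconjBy_propagator {F X Y : 𝔸} (h : SemiconjBy F X Y) (s : ℝ) :
    SemiconjBy F (propagator X s) (propagator Y s) := by
  let _ : NormedAlgebra ℚ 𝔸 := NormedAlgebra.restrictScalars ℚ ℂ 𝔸
  refine SemiconjBy.exp_right ?_
  rw [SemiconjBy, mul_smul_comm, h.eq, smul_mul_assoc]

theorem propagator_pow (X : 𝔸) (s : ℝ) (n : ℕ) : propagator X s ^ n = propagator X (n * s) := by
  let _ : NormedAlgebra ℚ 𝔸 := NormedAlgebra.restrictScalars ℚ ℂ 𝔸
  rw [propagator, ← exp_nsmul, propagator, ← Nat.cast_smul_eq_nsmul ℂ, smul_smul]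
  congr 2
  push_cast
  ring

variable [StarRing 𝔸] [CStarRing 𝔸] [StarModule ℂ 𝔸]

theorem norm_propagator_le_one {X : 𝔸} (hX : star X = X) (s : ℝ) : ‖propagator X s‖ ≤ 1 := by
  let _ : NormedAlgebra ℚ 𝔸 := NormedAlgebra.restrictScalars ℚ ℂ 𝔸
  have h : (-(Complex.I * (s : ℂ))) • X ∈ skewAdjoint 𝔸 := by
    rw [skewAdjoint.mem_iff, star_smul, hX, ← neg_smul]
    congr 1
    simp
  have hu := exp_mem_unitary_of_mem_skewAdjoint h
  exact norm_le_one_of_star_mul_self_eq_one (Unitary.mem_iff.1 hu).1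

theorem norm_strang_propagator_sub_le {W T : 𝔸} (hW : star W = W) (hT : star T = T) {a b s : ℝ}
    (ha : ‖W‖ ≤ a) (hb : ‖T‖ ≤ b) (hs : 0 ≤ s) :
    ‖propagator W (s / 2) * propagator T s * propagator W (s / 2) - propagator (W + T) s‖ ≤
      s ^ 3 / 3 * (a * b * (a + b)) := by
  set X : 𝔸 := (1 / 2 : ℝ) • (-(Complex.I • W)) with hX
  set Y : 𝔸 := -(Complex.I • T) with hY
  have eX : ∀ u : ℝ, exp (u • X) = propagator W (u / 2) := fun u => by
    rw [propagator_eq_exp_smul, hX, smul_smul]; congr 2; ring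
  have eY : ∀ u : ℝ, exp (u • Y) = propagator T u := fun u => by
    rw [propagator_eq_exp_smul, hY]
  have eH : ∀ u : ℝ, exp (u • (X + Y + X)) = propagator (W + T) u := fun u => by
    rw [propagator_eq_exp_smul]
    congr 2
    rw [add_right_comm, hX, ← add_smul, hY, smul_add, neg_add]
    norm_num
  have hWT : star (W + T) = W + T := by rw [star_add, hW, hT]
  have hmain := norm_strang_sub_exp_le (X := X) (Y := Y)
    (fun u => (eX u) ▸ norm_propagator_le_one hW _) (fun u => (eY u) ▸ norm_propagator_le_one hT _)
    (fun u => (eH u) ▸ norm_propagator_le_one hWT _) hs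
  rw [eX, eY, eH] at hmain
  refine hmain.trans ?_
  have ha0 : 0 ≤ a := (norm_nonneg _).trans ha
  have hb0 : 0 ≤ b := (norm_nonneg _).trans hb
  have nX : ‖X‖ ≤ a / 2 := by
    rw [hX, norm_smul, norm_neg, norm_smul, Complex.norm_I, one_mul]
    norm_num
    linarith
  have nY : ‖Y‖ ≤ b := by
    rw [hY, norm_neg, norm_smul, Complex.norm_I, one_mul]
    exact hb
  have h1 : ‖X * (X * Y - Y * X) - (X * Y - Y * X) * X‖ ≤ a ^ 2 * b := by
    refine (norm_double_commutator_le X Y).trans ?_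
    calc 4 * ‖X‖ ^ 2 * ‖Y‖ ≤ 4 * (a / 2) ^ 2 * b := by gcongr
      _ = _ := by ring
  have h2 : ‖Y * (Y * X - X * Y) - (Y * X - X * Y) * Y‖ ≤ 2 * b ^ 2 * a := by
    refine (norm_double_commutator_le Y X).trans ?_
    calc 4 * ‖Y‖ ^ 2 * ‖X‖ ≤ 4 * b ^ 2 * (a / 2) := by gcongr
      _ = _ := by ring
  calc _ ≤ s ^ 3 / 6 * (a ^ 2 * b + 2 * b ^ 2 * a) := by gcongr
    _ ≤ s ^ 3 / 6 * (2 * (a * b * (a + b))) := by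
      gcongr
      nlinarith [mul_nonneg (sq_nonneg a) hb0]
    _ = _ := by ring

/-- Restriction to the range of a projection `P` that commutes with `W` and `T`: only the norms of
`W P` and `T P` enter the error of the splitting. -/
theorem norm_splitStep_pow_sub_mul_proj_le {W T D G P : 𝔸} (hW : star W = W) (hT : star T = T)
    (hP : star P = P) (hPP : P * P = P) (hPW : Commute P W) (hPT : Commute P T)
    (hG : G * star G = 1) (hGD : G * D = T * G) {a b : ℝ} (ha : ‖W * P‖ ≤ a) (hb : ‖T * P‖ ≤ b)
    {s : ℝ} (hs : 0 ≤ s) (n : ℕ) :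
    ‖((propagator W (s / 2) * G * propagator D s * star G * propagator W (s / 2)) ^ n -
        propagator (W + T) s ^ n) * P‖ ≤ n * (s ^ 3 / 3 * (a * b * (a + b))) := by
  have hstep : propagator W (s / 2) * G * propagator D s * star G * propagator W (s / 2) =
      propagator W (s / 2) * propagator T s * propagator W (s / 2) := by
    rw [mul_assoc (propagator W (s / 2)) G, (semiconjBy_propagator (F := G) hGD s).eq, mul_assoc,
      mul_assoc, ← mul_assoc (propagator T s * G), mul_assoc (propagator T s) G, hG, mul_one,
      ← mul_assoc]
  have hsemi : ∀ {X : 𝔸}, Commute P X → SemiconjBy P (X * P) X := fun {X} h => by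
    rw [SemiconjBy, ← mul_assoc, h.eq, mul_assoc, hPP]
  have hself : ∀ {X : 𝔸}, star X = X → Commute P X → star (X * P) = X * P := fun {X} hX h => by
    rw [star_mul, hX, hP, h.eq]
  have hWs := semiconjBy_propagator (hsemi hPW) (s / 2)
  have hTs := semiconjBy_propagator (hsemi hPT) s
  have hHs : SemiconjBy P (propagator (W * P + T * P) s) (propagator (W + T) s) := by
    rw [← add_mul]
    exact semiconjBy_propagator (hsemi (hPW.add_right hPT)) s
  have hall := (((hWs.mul_right hTs).mul_right hWs).pow_right n).sub_right (hHs.pow_right n)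
  have hP1 : ‖P‖ ≤ 1 := by
    have := CStarRing.norm_star_mul_self (x := P)
    rw [hP, hPP] at this
    nlinarith [norm_nonneg P]
  have hWP := hself hW hPW
  have hTP := hself hT hPT
  have hWTP : star (W * P + T * P) = W * P + T * P := by rw [star_add, hWP, hTP]
  rw [hstep, ← hall.eq]
  refine (norm_mul_le_of_norm_le_one hP1).trans ((norm_pow_sub_pow_le ?_
    (norm_propagator_le_one hWTP s) n).trans ?_)
  · exact (norm_mul_le_of_norm_le_one' (norm_propagator_le_one hWP _)).trans
      ((norm_mul_le_of_norm_le_one (norm_propagator_le_one hWP _)).trans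
        (norm_propagator_le_one hTP _))
  · exact mul_le_mul_of_nonneg_left (norm_strang_propagator_sub_le hWP hTP ha hb hs)
      (Nat.cast_nonneg n)

end SectorError

/-! ### The split-operator formula in a particle number sector -/

theorem kinetic_eq_conj {Ω : ℝ} (hM : 0 < M) (hΩ : 0 < Ω) :
    kinetic M Ω = star (FFFT M Ω) * kineticDiag M Ω * FFFT M Ω := by
  rw [star_FFFT_mul_kineticDiag hM hΩ, mul_assoc, star_FFFT_mul_FFFT hM hΩ, mul_one]

theorem norm_FFFT_le_one {Ω : ℝ} (hM : 0 < M) (hΩ : 0 < Ω) : ‖FFFT M Ω‖ ≤ 1 :=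
  norm_le_one_of_star_mul_self_eq_one (star_FFFT_mul_FFFT hM hΩ)

theorem norm_star_FFFT_le_one {Ω : ℝ} (hM : 0 < M) (hΩ : 0 < Ω) : ‖star (FFFT M Ω)‖ ≤ 1 := by
  refine norm_le_one_of_star_mul_self_eq_one ?_
  rw [star_star]
  exact FFFT_mul_star_FFFT hM hΩ

theorem star_kinetic {Ω : ℝ} (hM : 0 < M) (hΩ : 0 < Ω) : star (kinetic M Ω) = kinetic M Ω := by
  obtain ⟨f, hf, -⟩ := kineticDiag_eq_realDiag (M := M) (Ω := Ω)
  rw [kinetic_eq_conj hM hΩ, star_mul, star_mul, star_star, hf, star_realDiag, mul_assoc]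

theorem commute_sectorProj_FFFT (Ω : ℝ) (η : ℕ) :
    Commute (sectorProj (Mode M) η) (FFFT M Ω) := by
  have h := (commute_sectorProj (commute_sum_number_star_FFFT (M := M) Ω) η).eq
  have h' := congrArg star h
  rw [star_mul, star_mul, star_star, star_sectorProj] at h'
  exact h'.symm

theorem commute_sectorProj_kinetic {Ω : ℝ} (hM : 0 < M) (hΩ : 0 < Ω) (η : ℕ) :
    Commute (sectorProj (Mode M) η) (kinetic M Ω) := by
  obtain ⟨f, hf, -⟩ := kineticDiag_eq_realDiag (M := M) (Ω := Ω)
  rw [kinetic_eq_conj hM hΩ, hf]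
  exact ((commute_sectorProj (commute_sum_number_star_FFFT Ω) η).mul_right
    (commute_sectorProj_realDiag η f)).mul_right (commute_sectorProj_FFFT Ω η)

theorem norm_kinetic_mul_sectorProj_le {Ω : ℝ} (hM : 0 < M) (hΩ : 0 < Ω) (η : ℕ) :
    ‖kinetic M Ω * sectorProj (Mode M) η‖ ≤ 24 * M ^ 2 / (Ω ^ (1 / 3 : ℝ)) ^ 2 * η := by
  obtain ⟨f, hf, hb⟩ := kineticDiag_eq_realDiag (M := M) (Ω := Ω)
  have e : kinetic M Ω * sectorProj (Mode M) η =
      star (FFFT M Ω) * (realDiag f * sectorProj (Mode M) η * FFFT M Ω) := by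
    rw [kinetic_eq_conj hM hΩ, hf, mul_assoc, ← (commute_sectorProj_FFFT Ω η).eq]
    simp only [mul_assoc]
  rw [e]
  refine (norm_mul_le_of_norm_le_one (norm_star_FFFT_le_one hM hΩ)).trans
    ((norm_mul_le_of_norm_le_one' (norm_FFFT_le_one hM hΩ)).trans ?_)
  refine norm_realDiag_mul_sectorProj_le (by positivity) fun S hS => ?_
  rw [← hS]
  exact hb S

/-- The electrostatic energy is diagonal and of order `η² M / Ω^{1/3}` with `η` electrons and nuclei
of total absolute charge `O(η)`. -/
theorem potential_eq_realDiag {Ω : ℝ} (hΩ : 0 < Ω) {J : ℕ} (ζ : Fin J → ℝ) (R : Fin J → Fin 3 → ℝ)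
    {A : ℝ} {η : ℕ} (hA : ∑ j, |ζ j| ≤ A * η) :
    ∃ f : Finset (Mode M) → ℝ, external M Ω ζ R + repulsion M Ω = realDiag f ∧
      ∀ S, S.card = η → |f S| ≤ 9 * (|A| + 1) * (η ^ 2 * M / Ω ^ (1 / 3 : ℝ)) := by
  have hL : 0 < Ω ^ (1 / 3 : ℝ) := Real.rpow_pos_of_pos hΩ _
  obtain ⟨f, hf, hfb⟩ := external_eq_realDiag (M := M) hΩ ζ R
  obtain ⟨g, hg, hgb⟩ := repulsion_eq_realDiag (M := M) hΩ
  refine ⟨fun S => f S + g S, by rw [hf, hg, realDiag_add], fun S hS => ?_⟩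
  have h1 := hfb S
  have h2 := hgb S
  rw [hS] at h1 h2
  have h3 : 9 * (∑ j, |ζ j|) * M / Ω ^ (1 / 3 : ℝ) * η ≤
      9 * (|A| * η) * M / Ω ^ (1 / 3 : ℝ) * η := by
    have : ∑ j, |ζ j| ≤ |A| * η :=
      hA.trans (mul_le_mul_of_nonneg_right (le_abs_self A) (Nat.cast_nonneg η))
    gcongr
  calc |f S + g S| ≤ |f S| + |g S| := abs_add_le _ _
    _ ≤ 9 * (|A| * η) * M / Ω ^ (1 / 3 : ℝ) * η + 9 * M / Ω ^ (1 / 3 : ℝ) * (η : ℝ) ^ 2 :=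
      add_le_add (h1.trans h3) h2
    _ = _ := by ring

theorem norm_splitStep_pow_sub_evolve_mul_sectorProj_le {Ω : ℝ} (hM : 0 < M) (hΩ : 0 < Ω) {J : ℕ}
    (ζ : Fin J → ℝ) (R : Fin J → Fin 3 → ℝ) {A : ℝ} {η : ℕ} (hA : ∑ j, |ζ j| ≤ A * η)
    {s : ℝ} (hs : 0 ≤ s) (r : ℕ) {a b : ℝ}
    (ha : a = 9 * (|A| + 1) * (η ^ 2 * M / Ω ^ (1 / 3 : ℝ)))
    (hb : b = 24 * M ^ 2 / (Ω ^ (1 / 3 : ℝ)) ^ 2 * η) :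
    ‖(splitStep M Ω ζ R s ^ r - evolve (hamiltonian M Ω ζ R) (r * s)) * sectorProj (Mode M) η‖ ≤
      r * (s ^ 3 / 3 * (a * b * (a + b))) := by
  have hL : 0 < Ω ^ (1 / 3 : ℝ) := Real.rpow_pos_of_pos hΩ _
  obtain ⟨f, hf, hfb⟩ := potential_eq_realDiag (M := M) hΩ ζ R hA
  have hW : ‖realDiag f * sectorProj (Mode M) η‖ ≤ a := by
    rw [ha]
    exact norm_realDiag_mul_sectorProj_le (by positivity) hfb
  have hT : ‖kinetic M Ω * sectorProj (Mode M) η‖ ≤ b := by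
    rw [hb]
    exact norm_kinetic_mul_sectorProj_le hM hΩ η
  have hG : star (FFFT M Ω) * star (star (FFFT M Ω)) = 1 := by
    rw [star_star]; exact star_FFFT_mul_FFFT hM hΩ
  have key := norm_splitStep_pow_sub_mul_proj_le (star_realDiag f) (star_kinetic hM hΩ)
    (star_sectorProj η) (sectorProj_mul_self η) (commute_sectorProj_realDiag η f)
    (commute_sectorProj_kinetic hM hΩ η) hG (star_FFFT_mul_kineticDiag hM hΩ) hW hT hs r
  rw [propagator_pow, star_star, ← hf, add_comm _ (kinetic M Ω), ← add_assoc] at key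
  exact key

/-! ### The number of steps -/

/-- The square of the step scale, with all fractional powers resolved. -/
theorem stepScale_sq_mul {M η : ℕ} {Ω t ε : ℝ} (hM : 0 < M) (hΩ : 0 < Ω) (ht : 0 ≤ t)
    (hε : 0 < ε) :
    stepScale η (M ^ 3) Ω t ε ^ 2 * ε = t ^ 3 * ((η : ℝ) ^ 4 * (M : ℝ) ^ 5 /
      (Ω ^ (1 / 3 : ℝ)) ^ 5 * (1 + (η : ℝ) * Ω ^ (1 / 3 : ℝ) / M)) := by
  have hM' : (0 : ℝ) < M := by exact_mod_cast hM
  have pw : ∀ {x : ℝ} (y : ℝ) (n : ℕ), 0 ≤ x → (x ^ y) ^ n = x ^ (y * n) := fun y n hx => by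
    rw [← Real.rpow_natCast, ← Real.rpow_mul hx]
  have hN : ((M ^ 3 : ℕ) : ℝ) = (M : ℝ) ^ (3 : ℝ) := by
    push_cast; rw [← Real.rpow_natCast]; norm_num
  have e1 : ((M ^ 3 : ℕ) : ℝ) ^ (1 / 3 : ℝ) = M := by
    rw [hN, ← Real.rpow_mul hM'.le]; norm_num
  have e2 : (((M ^ 3 : ℕ) : ℝ) ^ (5 / 6 : ℝ)) ^ 2 = (M : ℝ) ^ 5 := by
    rw [pw _ _ (by positivity), hN, ← Real.rpow_mul hM'.le, ← Real.rpow_natCast]; norm_num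
  have e3 : (t ^ (3 / 2 : ℝ)) ^ 2 = t ^ 3 := by
    rw [pw _ _ ht, ← Real.rpow_natCast]; norm_num
  have e4 : (Ω ^ (5 / 6 : ℝ)) ^ 2 = (Ω ^ (1 / 3 : ℝ)) ^ 5 := by
    rw [pw _ _ hΩ.le, pw _ _ hΩ.le]; norm_num
  have hL : 0 < Ω ^ (1 / 3 : ℝ) := Real.rpow_pos_of_pos hΩ _
  rw [stepScale, e1, mul_pow, div_pow, mul_pow, mul_pow, mul_pow, e2, e3, e4,
    Real.sq_sqrt hε.le, Real.sq_sqrt (by positivity)]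
  field_simp

/-- The error bound `t³ a b (a + b) / (3 r²)` is at most `ε` once `r` is a sufficiently large
constant times the step scale. -/
theorem trotter_error_le {M η r : ℕ} {Ω t ε B a b : ℝ} (hM : 0 < M) (hΩ : 0 < Ω) (ht : 0 ≤ t)
    (hε : 0 < ε) (hB : 9 ≤ B) (ha : a = B * (η ^ 2 * M / Ω ^ (1 / 3 : ℝ)))
    (hb : b = 24 * M ^ 2 / (Ω ^ (1 / 3 : ℝ)) ^ 2 * η)
    (hr : 8 * B * (B + 24) * max 1 (stepScale η (M ^ 3) Ω t ε) ≤ r) :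
    r * ((t / r) ^ 3 / 3 * (a * b * (a + b))) ≤ ε := by
  have hM' : (0 : ℝ) < M := by exact_mod_cast hM
  have hL : 0 < Ω ^ (1 / 3 : ℝ) := Real.rpow_pos_of_pos hΩ _
  have hsq := stepScale_sq_mul (η := η) hM hΩ ht hε
  have hX : 0 ≤ stepScale η (M ^ 3) Ω t ε := by rw [stepScale]; positivity
  set X := stepScale η (M ^ 3) Ω t ε
  set L := Ω ^ (1 / 3 : ℝ)
  set K := 8 * B * (B + 24) with hK
  have hK1 : 1 ≤ K := by nlinarith
  have hr1 : 1 ≤ (r : ℝ) := by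
    have : K * 1 ≤ K * max 1 X := mul_le_mul_of_nonneg_left (le_max_left _ _) (by linarith)
    linarith
  have hrX : K * X ≤ r :=
    (mul_le_mul_of_nonneg_left (le_max_right _ _) (by linarith)).trans hr
  have hr2 : K * X ^ 2 ≤ (r : ℝ) ^ 2 := by
    have h1 : (K * X) ^ 2 ≤ (r : ℝ) ^ 2 := pow_le_pow_left₀ (by positivity) hrX 2
    have h2 : K * X ^ 2 ≤ (K * X) ^ 2 := by
      rw [mul_pow]
      exact mul_le_mul_of_nonneg_right (by nlinarith) (sq_nonneg X)
    exact h2.trans h1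
  have hab : a * b * (a + b) ≤ 3 * K * ((η : ℝ) ^ 4 * (M : ℝ) ^ 5 / L ^ 5 * (1 + η * L / M)) := by
    have hsum : a + b ≤ (B + 24) * (η * M ^ 2 / L ^ 2 * (1 + η * L / M)) := by
      have e : (η : ℝ) * M ^ 2 / L ^ 2 * (1 + η * L / M) = η * M ^ 2 / L ^ 2 + η ^ 2 * M / L := by
        field_simp
      rw [e, ha, hb]
      have p1 : 0 ≤ (η : ℝ) * M ^ 2 / L ^ 2 := by positivity
      have p2 : 0 ≤ (η : ℝ) ^ 2 * M / L := by positivity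
      have e2 : 24 * (M : ℝ) ^ 2 / L ^ 2 * η = 24 * (η * M ^ 2 / L ^ 2) := by ring
      rw [e2]
      nlinarith
    have hprod : a * b = 24 * B * ((η : ℝ) ^ 3 * M ^ 3 / L ^ 3) := by
      rw [ha, hb]
      field_simp
    rw [hprod]
    refine (mul_le_mul_of_nonneg_left hsum (by positivity)).trans_eq ?_
    rw [hK]
    field_simp
    ring
  have hr0 : (0 : ℝ) < r := by linarith
  have e : (r : ℝ) * ((t / r) ^ 3 / 3 * (a * b * (a + b))) =
      t ^ 3 / 3 * (a * b * (a + b)) / r ^ 2 := by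
    field_simp
  rw [e, div_le_iff₀ (by positivity)]
  calc t ^ 3 / 3 * (a * b * (a + b))
      ≤ t ^ 3 / 3 * (3 * K * ((η : ℝ) ^ 4 * (M : ℝ) ^ 5 / L ^ 5 * (1 + η * L / M))) :=
        mul_le_mul_of_nonneg_left hab (by positivity)
    _ = ε * (K * X ^ 2) := by linear_combination -K * hsq
    _ ≤ ε * r ^ 2 := mul_le_mul_of_nonneg_left hr2 hε.le

end PlaneWaveDual

theorem mainTheorem1 (A : ℝ) :
    ∃ c₁ c₂ : ℝ, 0 < c₁ ∧ c₁ ≤ c₂ ∧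
      ∀ (M : ℕ) (η : ℕ) (Ω t ε : ℝ), 0 < M → 0 < Ω → 0 ≤ t → 0 < ε →
        ∃ r : ℕ,
          c₁ * max 1 (PlaneWaveDual.stepScale η (M ^ 3) Ω t ε) ≤ (r : ℝ) ∧
          (r : ℝ) ≤ c₂ * max 1 (PlaneWaveDual.stepScale η (M ^ 3) Ω t ε) ∧
          ∀ (J : ℕ) (ζ : Fin J → ℝ) (R : Fin J → Fin 3 → ℝ),
            ∑ j, ζ j = (η : ℝ) → ∑ j, |ζ j| ≤ A * (η : ℝ) →
            ∀ ψ ∈ PlaneWaveDual.particleManifold (PlaneWaveDual.Mode M) η, ‖ψ‖ = 1 →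
              ‖⟪ψ, (PlaneWaveDual.splitStep M Ω ζ R (t / r) ^ r -
                  PlaneWaveDual.evolve (PlaneWaveDual.hamiltonian M Ω ζ R) t) ψ⟫_ℂ‖ ≤ ε := by
  -- `8 B (B + 24)` is the constant in the error bound; it is at least `1`, so that `r` may be taken
  -- proportional to it rather than to its square root
  set B := 9 * (|A| + 1) with hBdef
  have hB : 9 ≤ B := by nlinarith [abs_nonneg A]
  have hK : 1 ≤ 8 * B * (B + 24) := by nlinarith
  refine ⟨8 * B * (B + 24), 8 * B * (B + 24) + 1, by linarith, by linarith, ?_⟩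
  intro M η Ω t ε hM hΩ ht hε
  set m := max 1 (PlaneWaveDual.stepScale η (M ^ 3) Ω t ε) with hm
  have hm1 : 1 ≤ m := le_max_left _ _
  have hr := Nat.le_ceil (8 * B * (B + 24) * m)
  refine ⟨⌈8 * B * (B + 24) * m⌉₊, hr, ?_, ?_⟩
  · have := (Nat.ceil_lt_add_one (by positivity : 0 ≤ 8 * B * (B + 24) * m)).le
    linarith
  intro J ζ R _ hA ψ hψ hψ1
  set r := ⌈8 * B * (B + 24) * m⌉₊
  have hr0 : (r : ℝ) ≠ 0 := by
    have : 1 ≤ 8 * B * (B + 24) * m := by nlinarith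
    linarith
  have herr := (PlaneWaveDual.norm_splitStep_pow_sub_evolve_mul_sectorProj_le hM hΩ ζ R hA
    (div_nonneg ht (Nat.cast_nonneg r)) r rfl rfl).trans
    (PlaneWaveDual.trotter_error_le hM hΩ ht hε hB rfl rfl hr)
  rw [mul_div_cancel₀ t hr0] at herr
  set E := PlaneWaveDual.splitStep M Ω ζ R (t / r) ^ r -
    PlaneWaveDual.evolve (PlaneWaveDual.hamiltonian M Ω ζ R) t
  have hE : E ψ = (E * PlaneWaveDual.sectorProj (PlaneWaveDual.Mode M) η) ψ := by
    rw [mul_apply_eq_comp, PlaneWaveDual.sectorProj_apply_of_mem hψ]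
  calc ‖⟪ψ, E ψ⟫_ℂ‖ ≤ ‖ψ‖ * ‖E ψ‖ := norm_inner_le_norm _ _
    _ = ‖E ψ‖ := by rw [hψ1, one_mul]
    _ ≤ ‖E * PlaneWaveDual.sectorProj (PlaneWaveDual.Mode M) η‖ := by
        rw [hE]
        exact ContinuousLinearMap.unit_le_opNorm _ _ hψ1.le
    _ ≤ ε := herr
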